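/- Let $n\ge 1$, $R>0$, $0<\alpha<1$, $D=\{z\in\mathbb C:|z|\le R\}$, and let $D^n\subset\mathbb C^n$ be the closed polydisc. For $f:D^n\to\mathbb C$ let $\Delta_i f$ be the difference of $f(\dots,z_i,\dots)$ and $f(\dots,z_i',\dots)$ (other coordinates fixed), and for distinct indices $i_1,\dots,i_k$ put $\Delta_{i_1\cdots i_k}f=\Delta_{i_k}\cdots\Delta_{i_1}f$ and $$\delta_{i_1\cdots i_k}f=\frac{\Delta_{i_1\cdots i_k}f}{|z_{i_1}-z'_{i_1}|^\alpha\cdots|z_{i_k}-z'_{i_k}|^\alpha}\qquad(z_{i_j}\ne z'_{i_j}).$$ Let $\mathcal C^\alpha(D^n)$ be the set of $f$ for which, for every $k=0,\dots,n$, all $\delta_{i_1\cdots i_k}f$ with distinct $i_1,\dots,i_k$ are bounded (for $k=0$: $f$ is bounded). With $d\bar\zeta\wedge d\zeta=2i\,dx\,dy$, define $$T_jf(z)=\frac{-1}{2\pi i}\int_D\frac{f(z_1,\dots,z_{j-1},\zeta,z_{j+1},\dots,z_n)}{\zeta-z_j}\,d\bar\zeta\wedge d\zeta,\qquad \overline T_jf(z)=\frac{-1}{2\pi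 i}\int_D\frac{f(z_1,\dots,z_{j-1},\zeta,z_{j+1},\dots,z_n)}{\bar\zeta-\bar z_j}\,d\bar\zeta\wedge d\zeta .$$ For multi-indices $\mu,\nu$ with all $\mu_j,\nu_j\ge1$ put $T^\mu\overline T^\nu f=T_1^{\mu_1}\cdots T_n^{\mu_n}\overline T_1^{\nu_1}\cdots\overline T_n^{\nu_n}f$. For integers $m,k,l\ge 1$ and $a,b\in D$ put $$C_1(a,b,k)=\sum_{l=1}^{k-1}\frac{-b^l}{l}\sum_{j=0}^{k-1-l}\binom{k-1}{j}a^{k-1-l-j}(-b)^j,$$ $$C_2(a,b,l,k)=\sum_{\substack{0\le p\le l,\ 0\le q\le k-1\\ p\le q}}\binom lp\binom{k-1}{q}R^{2p}(-\bar b)^{l-p}(-b)^{k-1-q}a^{q-p},$$ and, for $a\ne b$, with the principal logarithm, $$C_3(a,b,m,k)=(\bar b-\bar a)^{m-1}\Big(C_1(a,b,k)+(a-b)^{k-1}\ln\frac{R^2-a\bar b}{|a-b|^2}\Big)+\sum_{l=1}^{m-1}\binom{m-1}{l}(\bar b-\bar a)^{m-1-l}\Big(-\frac1l(\bar a-\bar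 b)^l(a-b)^{k-1}+\frac1l C_2(a,b,l,k)\Big)$$ (empty sums are $0$). Then for every $f\in\mathcal C^\alpha(D^n)$ one has $T^\mu\overline T^\nu f\in\mathcal C^\alpha(D^n)$, and for every $z\in D^n$ the integral below converges absolutely and $$T^\mu\overline T^\nu f(z)=\frac{(-1)^{|\mu|}}{(\mu-\mathbf 1)!\,(\nu-\mathbf 1)!\,(2\pi i)^n}\int_D\cdots\int_D\ \prod_{j=1}^nC_3(z_j,\eta_j,\mu_j,\nu_j)\,f(\eta)\,d\bar\eta_1\wedge d\eta_1\cdots d\bar\eta_n\wedge d\eta_n,$$ where $|\mu|=\sum_j\mu_j$, $(\mu-\mathbf 1)!=\prod_j(\mu_j-1)!$ and $(\nu-\mathbf 1)!=\prod_j(\nu_j-1)!$. -/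

import Mathlib

open MeasureTheory

noncomputable section

namespace PolydiscGreen

/-- The closed polydisc `D^n`, where `D = {z ∈ ℂ : |z| ≤ R}`. -/
def polydisc (n : ℕ) (R : ℝ) : Set (Fin n → ℂ) :=
  Set.pi Set.univ (fun _ => Metric.closedBall (0 : ℂ) R)

/-- Iterated partial differences `Δ_{i_k} ⋯ Δ_{i_1} f` for the list `[i_k, …, i_1]`, where
`Δ_i g` is the value of `g` at `z_i` minus its value at `z'_i`.  The primed coordinates `z'_i` are
the entries of `z'`; only those with `i` in the list are used. -/
def multiDiff {n : ℕ} (f : (Fin n → ℂ) → ℂ) :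
    List (Fin n) → (Fin n → ℂ) → (Fin n → ℂ) → ℂ
  | [], z, _ => f z
  | i :: l, z, z' => multiDiff f l z z' - multiDiff f l (Function.update z i (z' i)) z'

/-- The `k`-th order `α`-Hölder difference quotient
`δ_{i_1 ⋯ i_k} f = Δ_{i_1 ⋯ i_k} f / (|z_{i_1} - z'_{i_1}|^α ⋯ |z_{i_k} - z'_{i_k}|^α)`. -/
def holderQuotient {n : ℕ} (α : ℝ) (f : (Fin n → ℂ) → ℂ) (l : List (Fin n))
    (z z' : Fin n → ℂ) : ℂ :=
  multiDiff f l z z' / (((l.map (fun i => ‖z i - z' i‖ ^ α)).prod : ℝ) : ℂ)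

/-- The class `𝒞^α(D^n)`: for every `k = 0, …, n`, the difference quotients of order `k` along
distinct indices are bounded on the polydisc (for `k = 0`: `f` is bounded).
Only the values of `f` on the polydisc matter. -/
def MemHolder {n : ℕ} (R α : ℝ) (f : (Fin n → ℂ) → ℂ) : Prop :=
  ∀ k : ℕ, k ≤ n → ∃ C : ℝ, ∀ l : List (Fin n), l.Nodup → l.length = k →
    ∀ z ∈ polydisc n R, ∀ z' ∈ polydisc n R, (∀ i ∈ l, z i ≠ z' i) →
      ‖holderQuotient α f l z z'‖ ≤ C

/-- `∫_D g(ζ) dζ̄ ∧ dζ`, with `dζ̄ ∧ dζ = 2i dx dy`. -/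
def discIntegral (R : ℝ) (g : ℂ → ℂ) : ℂ :=
  2 * Complex.I * ∫ ζ in Metric.closedBall (0 : ℂ) R, g ζ

/-- The operator `T_j`. -/
def opT {n : ℕ} (R : ℝ) (j : Fin n) (f : (Fin n → ℂ) → ℂ) : (Fin n → ℂ) → ℂ := fun z =>
  (-1 / (2 * (Real.pi : ℂ) * Complex.I)) *
    discIntegral R (fun ζ => f (Function.update z j ζ) / (ζ - z j))

/-- The operator `T̄_j`. -/
def opTbar {n : ℕ} (R : ℝ) (j : Fin n) (f : (Fin n → ℂ) → ℂ) : (Fin n → ℂ) → ℂ := fun z =>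
  (-1 / (2 * (Real.pi : ℂ) * Complex.I)) *
    discIntegral R
      (fun ζ => f (Function.update z j ζ) / (starRingEnd ℂ ζ - starRingEnd ℂ (z j)))

/-- `T^μ T̄^ν f = T_1^{μ_1} ⋯ T_n^{μ_n} T̄_1^{ν_1} ⋯ T̄_n^{ν_n} f`. -/
def greenOp {n : ℕ} (R : ℝ) (μ ν : Fin n → ℕ) (f : (Fin n → ℂ) → ℂ) : (Fin n → ℂ) → ℂ :=
  (List.finRange n).foldr (fun j g => (opT R j)^[μ j] g)
    ((List.finRange n).foldr (fun j g => (opTbar R j)^[ν j] g) f)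

/-- `C₁(a, b, k) = ∑_{l=1}^{k-1} (-b^l / l) ∑_{j=0}^{k-1-l} binom(k-1, j) a^{k-1-l-j} (-b)^j`
(for `k = 1` the sum is empty). -/
def C1 (a b : ℂ) (k : ℕ) : ℂ :=
  ∑ l ∈ Finset.Icc 1 (k - 1), (-(b ^ l) / (l : ℂ)) *
    ∑ j ∈ Finset.range (k - 1 - l + 1),
      ((k - 1).choose j : ℂ) * a ^ (k - 1 - l - j) * (-b) ^ j

/-- `C₂(a, b, l, ν)`, the sum over `0 ≤ p ≤ l`, `0 ≤ q ≤ ν - 1`, `p ≤ q` of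
`binom(l, p) binom(ν-1, q) R^{2p} (-b̄)^{l-p} (-b)^{ν-1-q} a^{q-p}`. -/
def C2 (R : ℝ) (a b : ℂ) (l ν : ℕ) : ℂ :=
  ∑ p ∈ Finset.range (l + 1), ∑ q ∈ Finset.Icc p (ν - 1),
    (l.choose p : ℂ) * ((ν - 1).choose q : ℂ) * (R : ℂ) ^ (2 * p) *
      (-(starRingEnd ℂ b)) ^ (l - p) * (-b) ^ (ν - 1 - q) * a ^ (q - p)

/-- The kernel `C₃(a, b, μ, ν)`; the logarithm is the principal one (for distinct `a, b` in the
closed disc its argument has positive real part).  For `μ = 1` the last sum is empty. -/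
def C3 (R : ℝ) (a b : ℂ) (μ ν : ℕ) : ℂ :=
  (starRingEnd ℂ b - starRingEnd ℂ a) ^ (μ - 1) *
      (C1 a b ν + (a - b) ^ (ν - 1) *
        Complex.log (((R : ℂ) ^ 2 - a * starRingEnd ℂ b) / ((‖a - b‖ ^ 2 : ℝ) : ℂ))) +
    ∑ l ∈ Finset.Icc 1 (μ - 1),
      ((μ - 1).choose l : ℂ) * (starRingEnd ℂ b - starRingEnd ℂ a) ^ (μ - 1 - l) *
        ((-1 / (l : ℂ)) * (starRingEnd ℂ a - starRingEnd ℂ b) ^ l * (a - b) ^ (ν - 1) +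
          (1 / (l : ℂ)) * C2 R a b l ν)

/-- `C₈(μ, ν) = (-1)^{|μ|} / ((μ - 1)! (ν - 1)! (2πi)^n)` in multi-index notation. -/
def C8 {n : ℕ} (μ ν : Fin n → ℕ) : ℂ :=
  (-1) ^ (∑ j, μ j) /
    ((∏ j, ((μ j - 1).factorial : ℂ)) * (∏ j, ((ν j - 1).factorial : ℂ)) *
      (2 * (Real.pi : ℂ) * Complex.I) ^ n)

end PolydiscGreen

end

noncomputable section

namespace PolydiscGreen

open Metric Set

/-! ### Integrable singularities on the disc -/

/-! Every operator involved is an integral operator acting in one coordinate, so the theorem reduces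
to three facts about kernels on the disc, combined by Fubini.

Regularity. A difference in a coordinate other than `j` passes under the integral of `T_j`, while a
difference in the coordinate `j` falls on the Cauchy kernel (`MemHolder.kernelOp`). Hence it
suffices that the kernel be bounded in `L¹` uniformly in its pole and that its `L¹` increment be
`O(|a - b| ^ α)`. The second bound (`exists_setIntegral_norm_inv_sub_inv_le`) is where `α < 1`
enters: it makes `|ζ| ^ (-(1 + α))` integrable in the plane.

Kernels. By partial fractions the Cauchy kernel composed with the kernel of `T ^ (m + 1)` is the
kernel of `T ^ (m + 2)` (`setIntegral_cauchyKernel_zero_mul`), and conjugation gives the same for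
`T̄`. Composing the two families produces `C3` (`setIntegral_cauchyKernel_mul_conjCauchyKernel`).
The explicit area integrals behind this are computed in polar coordinates: on `|ζ| = r` one has `ζ̄
= r² / ζ`, so each angular integral is a residue computation, and the radial integral then yields
monomials or, for one pole in `ζ` and one in `ζ̄`, the logarithm.

Several variables. `foldr_kernelOp_finRange` turns a product of one-variable operators into a single
integral over the polydisc, and `integrable_and_integral_prod_kernel_comp` composes two such
integrals. Absolute convergence comes from Fubini: the product of the `C3` factors with `f` is, up
to a nonzero constant, almost everywhere the inner integral of an integrable function, so `C3` never
has to be estimated. -/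

lemma integrableOn_norm_rpow_neg {s : ℝ} (hs : s < 2) (r : ℝ) :
    IntegrableOn (fun w : ℂ => ‖w‖ ^ (-s)) (ball 0 r) := by
  refine integrableOn_ball_of_norm_le_rpow (α := s) (C := 1) ?_ ?_ ?_ ?_
  · simp [Complex.finrank_real_complex]
  · simpa [Complex.finrank_real_complex] using hs
  · refine Filter.Eventually.of_forall fun x => ?_
    rw [one_mul, Real.norm_of_nonneg (by positivity)]
  · exact (measurable_norm.pow_const _).aestronglyMeasurable

lemma integrableOn_norm_sub_rpow_neg {s : ℝ} (hs : s < 2) (R : ℝ) (a : ℂ) :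
    IntegrableOn (fun ζ : ℂ => ‖ζ - a‖ ^ (-s)) (closedBall 0 R) := by
  have h := (measurePreserving_sub_right (volume : Measure ℂ) a).integrableOn_comp_preimage
    (measurableEmbedding_subRight a) (f := fun w : ℂ => ‖w‖ ^ (-s)) (s := ball 0 (R + ‖a‖ + 1))
  refine (h.2 (integrableOn_norm_rpow_neg hs _)).mono_set fun ζ hζ => ?_
  simp only [mem_closedBall, dist_zero_right, mem_preimage, mem_ball] at *
  linarith [norm_sub_le ζ a]

/-- Translating the pole to the origin moves the disc into one fixed ball of radius `2 * R + 1`,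
which makes the bound uniform in `a`. -/
lemma exists_setIntegral_norm_sub_rpow_neg_le {s : ℝ} (hs : s < 2) (R : ℝ) :
    ∃ C : ℝ, 0 ≤ C ∧ ∀ a ∈ closedBall (0 : ℂ) R,
      ∫ ζ in closedBall (0 : ℂ) R, ‖ζ - a‖ ^ (-s) ≤ C := by
  refine ⟨∫ w in ball (0 : ℂ) (2 * R + 1), ‖w‖ ^ (-s),
    integral_nonneg fun w => by positivity, fun a ha => ?_⟩
  have hmp := measurePreserving_sub_right (volume : Measure ℂ) a
  rw [← hmp.setIntegral_preimage_emb (measurableEmbedding_subRight a)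
    (fun w : ℂ => ‖w‖ ^ (-s)) (ball 0 (2 * R + 1))]
  refine setIntegral_mono_set ?_ (Filter.Eventually.of_forall fun w => by positivity)
    (LE.le.eventuallyLE fun ζ hζ => ?_)
  · exact (hmp.integrableOn_comp_preimage (measurableEmbedding_subRight a)).2
      (integrableOn_norm_rpow_neg hs _)
  · simp only [mem_closedBall, dist_zero_right, mem_preimage, mem_ball] at *
    linarith [norm_sub_le ζ a]

lemma integrableOn_norm_sub_inv (R : ℝ) (a : ℂ) :
    IntegrableOn (fun ζ : ℂ => ‖ζ - a‖⁻¹) (closedBall 0 R) := by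
  simpa [Real.rpow_neg_one] using integrableOn_norm_sub_rpow_neg (s := 1) (by norm_num) R a

lemma exists_setIntegral_norm_sub_inv_le (R : ℝ) :
    ∃ C : ℝ, 0 ≤ C ∧ ∀ a ∈ closedBall (0 : ℂ) R,
      ∫ ζ in closedBall (0 : ℂ) R, ‖ζ - a‖⁻¹ ≤ C := by
  simpa [Real.rpow_neg_one] using exists_setIntegral_norm_sub_rpow_neg_le (s := 1) (by norm_num) R

/-- Split `d = d ^ α * d ^ (1 - α)`. Since `d ≤ 2 * y`, the second factor is at most `2 * y * y ^
(-α) ≤ 2 * y * x ^ (-α)`, and the `y` cancels, leaving the whole singularity on the smaller distance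
`x`. -/
lemma div_mul_le_rpow {α x y d : ℝ} (hα₀ : 0 < α) (hα₁ : α < 1) (hx : 0 < x) (hxy : x ≤ y)
    (hd : 0 ≤ d) (hdy : d ≤ x + y) :
    d / (x * y) ≤ 2 * d ^ α * x ^ (-(1 + α)) := by
  have hy : 0 < y := hx.trans_le hxy
  rcases hd.eq_or_lt with rfl | hd'
  · rw [zero_div]; positivity
  have h1 : d ^ (1 - α) ≤ 2 * y ^ (1 - α) := by
    calc d ^ (1 - α) ≤ (2 * y) ^ (1 - α) :=
          Real.rpow_le_rpow hd (by linarith) (by linarith)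
      _ = 2 ^ (1 - α) * y ^ (1 - α) := Real.mul_rpow (by norm_num) hy.le
      _ ≤ 2 * y ^ (1 - α) := by
          gcongr
          calc (2 : ℝ) ^ (1 - α) ≤ 2 ^ (1 : ℝ) :=
                Real.rpow_le_rpow_of_exponent_le (by norm_num) (by linarith)
            _ = 2 := Real.rpow_one 2
  have h2 : y ^ (-α) ≤ x ^ (-α) := Real.rpow_le_rpow_of_nonpos hx hxy (by linarith)
  have e1 : d = d ^ α * d ^ (1 - α) := by
    rw [← Real.rpow_add hd']; simp
  have e2 : y ^ (1 - α) = y * y ^ (-α) := by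
    rw [sub_eq_add_neg, Real.rpow_add hy, Real.rpow_one]
  have e3 : x ^ (-(1 + α)) = x⁻¹ * x ^ (-α) := by
    rw [neg_add, Real.rpow_add hx, Real.rpow_neg_one]
  calc d / (x * y) = d ^ α * d ^ (1 - α) / (x * y) := by rw [← e1]
    _ ≤ d ^ α * (2 * (y * x ^ (-α))) / (x * y) := by
        gcongr
        exact h1.trans (by rw [e2]; gcongr)
    _ = 2 * d ^ α * x ^ (-(1 + α)) := by rw [e3]; field_simp

lemma norm_inv_sub_inv_le {α : ℝ} (hα₀ : 0 < α) (hα₁ : α < 1) {a b ζ : ℂ} (ha : ζ ≠ a)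
    (hb : ζ ≠ b) :
    ‖(ζ - a)⁻¹ - (ζ - b)⁻¹‖ ≤
      2 * ‖a - b‖ ^ α * (‖ζ - a‖ ^ (-(1 + α)) + ‖ζ - b‖ ^ (-(1 + α))) := by
  have hx : 0 < ‖ζ - a‖ := norm_pos_iff.2 (sub_ne_zero.2 ha)
  have hy : 0 < ‖ζ - b‖ := norm_pos_iff.2 (sub_ne_zero.2 hb)
  have e : ‖(ζ - a)⁻¹ - (ζ - b)⁻¹‖ = ‖a - b‖ / (‖ζ - a‖ * ‖ζ - b‖) := by
    rw [inv_sub_inv (sub_ne_zero.2 ha) (sub_ne_zero.2 hb), norm_div, norm_mul]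
    congr 2; ring
  have hd : ‖a - b‖ ≤ ‖ζ - a‖ + ‖ζ - b‖ := by
    calc ‖a - b‖ = ‖(ζ - b) - (ζ - a)‖ := by congr 1; ring
      _ ≤ _ := by rw [add_comm]; exact norm_sub_le _ _
  have h0 : 0 ≤ ‖a - b‖ ^ α := by positivity
  have hxa : 0 ≤ ‖ζ - a‖ ^ (-(1 + α)) := by positivity
  have hxb : 0 ≤ ‖ζ - b‖ ^ (-(1 + α)) := by positivity
  rw [e]
  rcases le_total ‖ζ - a‖ ‖ζ - b‖ with h | h
  · refine (div_mul_le_rpow hα₀ hα₁ hx h (norm_nonneg _) hd).trans ?_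
    gcongr; linarith
  · rw [mul_comm ‖ζ - a‖]
    refine (div_mul_le_rpow hα₀ hα₁ hy h (norm_nonneg _) (by linarith)).trans ?_
    gcongr; linarith

lemma ae_ne (a : ℂ) : ∀ᵐ ζ : ℂ, ζ ≠ a :=
  compl_mem_ae_iff.2 (by simp : volume ({a} : Set ℂ) = 0)

lemma exists_setIntegral_norm_inv_sub_inv_le {α : ℝ} (hα₀ : 0 < α) (hα₁ : α < 1) (R : ℝ) :
    ∃ C : ℝ, 0 ≤ C ∧ ∀ a ∈ closedBall (0 : ℂ) R, ∀ b ∈ closedBall (0 : ℂ) R,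
      ∫ ζ in closedBall (0 : ℂ) R, ‖(ζ - a)⁻¹ - (ζ - b)⁻¹‖ ≤ C * ‖a - b‖ ^ α := by
  have hs : 1 + α < 2 := by linarith
  obtain ⟨C, hC, h⟩ := exists_setIntegral_norm_sub_rpow_neg_le hs R
  refine ⟨4 * C, by positivity, fun a ha b hb => ?_⟩
  have ia := integrableOn_norm_sub_rpow_neg hs R a
  have ib := integrableOn_norm_sub_rpow_neg hs R b
  calc ∫ ζ in closedBall (0 : ℂ) R, ‖(ζ - a)⁻¹ - (ζ - b)⁻¹‖
      ≤ ∫ ζ in closedBall (0 : ℂ) R,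
          2 * ‖a - b‖ ^ α * (‖ζ - a‖ ^ (-(1 + α)) + ‖ζ - b‖ ^ (-(1 + α))) := by
        refine integral_mono_of_nonneg (Filter.Eventually.of_forall fun _ => norm_nonneg _)
          ((ia.add ib).const_mul _) (ae_restrict_of_ae ?_)
        filter_upwards [ae_ne a, ae_ne b] with ζ h1 h2
        exact norm_inv_sub_inv_le hα₀ hα₁ h1 h2
    _ = 2 * ‖a - b‖ ^ α * ((∫ ζ in closedBall (0 : ℂ) R, ‖ζ - a‖ ^ (-(1 + α))) +
          ∫ ζ in closedBall (0 : ℂ) R, ‖ζ - b‖ ^ (-(1 + α))) := by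
        rw [integral_const_mul, integral_add ia ib]
    _ ≤ 2 * ‖a - b‖ ^ α * (C + C) := by gcongr <;> [exact h a ha; exact h b hb]
    _ = 4 * C * ‖a - b‖ ^ α := by ring

/-! ### Integration over the disc in polar coordinates -/

lemma integrableOn_polarCoord {g : ℂ → ℂ} (hg : Integrable g) :
    IntegrableOn (fun p : ℝ × ℝ => p.1 • g (Complex.polarCoord.symm p)) polarCoord.target := by
  have h1 : Integrable (g ∘ Complex.measurableEquivRealProd.symm) :=
    (Complex.volume_preserving_equiv_real_prod.symm).integrable_comp_emb
      Complex.measurableEquivRealProd.symm.measurableEmbedding |>.2 hg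
  have h2 := (integrableOn_image_iff_integrableOn_abs_det_fderiv_smul volume
    (polarCoord.open_target.measurableSet)
    (fun p _ => (hasFDerivAt_polarCoord_symm p).hasFDerivWithinAt)
    polarCoord.symm.injOn (g ∘ Complex.measurableEquivRealProd.symm)).1 h1.integrableOn
  refine h2.congr_fun (fun p hp => ?_) polarCoord.open_target.measurableSet
  simp only [det_fderivPolarCoordSymm, Function.comp]
  rw [abs_of_pos hp.1]
  rfl

lemma circleIntegral_div_eq (g : ℂ → ℂ) {r : ℝ} (hr : r ≠ 0) :
    (∮ ζ in C(0, r), g ζ / ζ) = Complex.I * ∫ θ in (-Real.pi)..Real.pi, g (circleMap 0 r θ) := by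
  have hper : Function.Periodic (fun θ => g (circleMap 0 r θ)) (2 * Real.pi) := fun θ => by
    simp only [periodic_circleMap 0 r θ]
  have := hper.intervalIntegral_add_eq (-Real.pi) 0
  rw [show -Real.pi + 2 * Real.pi = Real.pi by ring, zero_add] at this
  rw [this, circleIntegral, ← intervalIntegral.integral_const_mul]
  refine intervalIntegral.integral_congr fun θ _ => ?_
  have : circleMap 0 r θ ≠ 0 := by simp [circleMap, hr]
  simp only [deriv_circleMap, smul_eq_mul]
  field_simp

/-- Polar coordinates, with `dθ` written as `dζ / (iζ)`, so `c r` is the mean of `g` on the circle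
of radius `r`. The hypothesis is needed only for almost every radius, because finitely many circles
may meet a pole. -/
lemma setIntegral_closedBall_eq {R : ℝ} (hR : 0 ≤ R) {g : ℂ → ℂ}
    (hg : IntegrableOn g (closedBall 0 R)) {c : ℝ → ℂ}
    (hc : ∀ᵐ r : ℝ, 0 < r → r ≤ R →
      (∮ ζ in C(0, r), g ζ / ζ) = 2 * Real.pi * Complex.I * c r) :
    ∫ ζ in closedBall 0 R, g ζ = 2 * Real.pi * ∫ r in (0 : ℝ)..R, (r : ℂ) * c r := by
  set G : ℂ → ℂ := (closedBall 0 R).indicator g with hG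
  have hGi : Integrable G := (integrable_indicator_iff measurableSet_closedBall).2 hg
  rw [← integral_indicator measurableSet_closedBall, ← Complex.integral_comp_polarCoord_symm]
  have hint := integrableOn_polarCoord hGi
  rw [show polarCoord.target = Ioi (0 : ℝ) ×ˢ Ioo (-Real.pi) Real.pi from rfl] at hint ⊢
  rw [Measure.volume_eq_prod, setIntegral_prod _ (by rwa [← Measure.volume_eq_prod])]
  have hsymm : ∀ r θ : ℝ, Complex.polarCoord.symm (r, θ) = circleMap 0 r θ := fun r θ => by
    simp [circleMap, Complex.exp_mul_I]
  simp only [hsymm]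
  rw [intervalIntegral.integral_of_le hR, ← integral_const_mul]
  rw [← Ioi_inter_Iic, ← setIntegral_indicator measurableSet_Iic]
  refine setIntegral_congr_ae measurableSet_Ioi ?_
  filter_upwards [hc] with r hr h0
  have h0 : 0 < r := h0
  rw [integral_smul, ← integral_Ioc_eq_integral_Ioo,
    ← intervalIntegral.integral_of_le (by linarith [Real.pi_pos])]
  have hmem : ∀ θ, circleMap 0 r θ ∈ closedBall (0 : ℂ) R ↔ r ≤ R := fun θ => by
    simp [abs_of_pos h0]
  by_cases hrR : r ≤ R
  · have h1 := hr h0 hrR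
    rw [circleIntegral_div_eq g h0.ne'] at h1
    rw [indicator_of_mem (show r ∈ Iic R from hrR)]
    have h2 : (∫ θ in (-Real.pi)..Real.pi, g (circleMap 0 r θ)) = 2 * Real.pi * c r := by
      apply mul_left_cancel₀ Complex.I_ne_zero
      rw [h1]; ring
    simp only [indicator_of_mem ((hmem _).2 hrR), h2, Complex.real_smul]
    ring
  · rw [indicator_of_notMem (show r ∉ Iic R from hrR)]
    simp only [indicator_of_notMem (mt (hmem _).1 hrR), intervalIntegral.integral_zero, smul_zero]

/-! ### Circle integrals -/

lemma sphere_conj {r : ℝ} (hr : 0 < r) {ζ : ℂ} (hζ : ζ ∈ sphere (0 : ℂ) r) :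
    ζ ≠ 0 ∧ starRingEnd ℂ ζ = (r : ℂ) ^ 2 / ζ := by
  have hn : ‖ζ‖ = r := by simpa using hζ
  have h0 : ζ ≠ 0 := by rw [← norm_pos_iff, hn]; exact hr
  refine ⟨h0, ?_⟩
  rw [eq_div_iff h0, mul_comm, Complex.mul_conj, Complex.normSq_eq_norm_sq, hn]
  push_cast; rfl

lemma circleIntegral_sub_inv {r : ℝ} (hr : 0 < r) {w : ℂ} (hw : ‖w‖ ≠ r) :
    (∮ ζ in C(0, r), (ζ - w)⁻¹) = 2 * Real.pi * Complex.I * (if ‖w‖ < r then 1 else 0) := by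
  split_ifs with h
  · rw [circleIntegral.integral_sub_inv_of_mem_ball (by simpa using h), mul_one]
  · rw [mul_zero]
    refine Complex.circleIntegral_eq_zero_of_differentiable_on_off_countable hr.le
      countable_empty ?_ ?_
    · refine ContinuousOn.inv₀ (by fun_prop) fun ζ hζ => sub_ne_zero.2 ?_
      rintro rfl
      exact hw (le_antisymm (by simpa using hζ) (not_lt.1 h))
    · intro ζ hζ
      have : ζ - w ≠ 0 := sub_ne_zero.2 (by
        rintro rfl
        exact h (by simpa using hζ.1))
      fun_prop (disch := assumption)

/-- With `ζ̄ = r² / ζ` the integrand becomes `ζ ^ p / (r² - z̄ζ)`. Its pole, if there is one, is the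
reflected point `r² / z̄`, which lies inside the circle exactly when `r < |z|`. -/
lemma circleIntegral_pow_div_conj_sub (p : ℕ) {r : ℝ} (hr : 0 < r) {z : ℂ} (hz : ‖z‖ ≠ r) :
    (∮ ζ in C(0, r), ζ ^ p / (starRingEnd ℂ ζ - starRingEnd ℂ z) / ζ) =
      2 * Real.pi * Complex.I *
        (if r ≤ ‖z‖ then -((r : ℂ) ^ (2 * p) / (starRingEnd ℂ z) ^ (p + 1)) else 0) := by
  have e1 : (∮ ζ in C(0, r), ζ ^ p / (starRingEnd ℂ ζ - starRingEnd ℂ z) / ζ) =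
      ∮ ζ in C(0, r), ζ ^ p / ((r : ℂ) ^ 2 - starRingEnd ℂ z * ζ) := by
    refine circleIntegral.integral_congr hr.le fun ζ hζ => ?_
    obtain ⟨h0, hc⟩ := sphere_conj hr hζ
    simp only [hc]
    rw [div_div, sub_mul, div_mul_cancel₀ _ h0]
  rw [e1]
  split_ifs with h
  · have hlt : r < ‖z‖ := lt_of_le_of_ne h (Ne.symm hz)
    have hz0 : starRingEnd ℂ z ≠ 0 := by
      rw [← norm_pos_iff, Complex.norm_conj]; exact hr.trans hlt
    have hz1 : 0 < ‖z‖ := hr.trans hlt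
    have e2 : (∮ ζ in C(0, r), ζ ^ p / ((r : ℂ) ^ 2 - starRingEnd ℂ z * ζ)) =
        ∮ ζ in C(0, r), (-(ζ ^ p / starRingEnd ℂ z)) / (ζ - (r : ℂ) ^ 2 / starRingEnd ℂ z) := by
      congr 1; funext ζ
      have : (r : ℂ) ^ 2 - starRingEnd ℂ z * ζ =
          -(starRingEnd ℂ z) * (ζ - (r : ℂ) ^ 2 / starRingEnd ℂ z) := by field_simp; ring
      rw [this, neg_mul, div_neg, ← div_div, neg_div]
    rw [e2, Complex.circleIntegral_div_sub_of_differentiable_on_off_countable countable_empty]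
    · rw [div_pow, ← pow_mul]; field_simp; ring
    · rw [mem_ball_zero_iff, norm_div, norm_pow, Complex.norm_conj, Complex.norm_real,
        Real.norm_of_nonneg hr.le, div_lt_iff₀ hz1]
      nlinarith
    · fun_prop
    · intro ζ _; fun_prop
  · have hlt : ‖z‖ < r := not_le.1 h
    have hne : ∀ ζ : ℂ, ‖ζ‖ ≤ r → (r : ℂ) ^ 2 - starRingEnd ℂ z * ζ ≠ 0 := fun ζ hζ h0 => by
      have := congrArg norm (sub_eq_zero.1 h0)
      rw [norm_pow, norm_mul, Complex.norm_conj, Complex.norm_real, Real.norm_of_nonneg hr.le] at this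
      nlinarith [norm_nonneg z, norm_nonneg ζ]
    rw [mul_zero]
    refine Complex.circleIntegral_eq_zero_of_differentiable_on_off_countable hr.le
      countable_empty ?_ ?_
    · exact ContinuousOn.div (by fun_prop) (by fun_prop) fun ζ hζ => hne ζ (by simpa using hζ)
    · intro ζ hζ
      have := hne ζ (by simpa using (ball_subset_closedBall hζ.1))
      fun_prop (disch := assumption)

lemma circleIntegral_conj_pow_mul_pow (p q : ℕ) {r : ℝ} (hr : 0 < r) :
    (∮ ζ in C(0, r), starRingEnd ℂ ζ ^ p * ζ ^ q / ζ) =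
      2 * Real.pi * Complex.I * (if p = q then (r : ℂ) ^ (2 * p) else 0) := by
  have e1 : (∮ ζ in C(0, r), starRingEnd ℂ ζ ^ p * ζ ^ q / ζ) =
      ∮ ζ in C(0, r), (r : ℂ) ^ (2 * p) * (ζ - 0) ^ ((q : ℤ) - p - 1) := by
    refine circleIntegral.integral_congr hr.le fun ζ hζ => ?_
    obtain ⟨h0, hc⟩ := sphere_conj hr hζ
    simp only [hc, sub_zero]
    rw [zpow_sub₀ h0, zpow_sub₀ h0, zpow_natCast, zpow_natCast, zpow_one, div_pow, pow_mul]
    field_simp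
  rw [e1, circleIntegral.integral_const_mul]
  split_ifs with h
  · subst h
    have : ((p : ℤ) - p - 1) = -1 := by ring
    simp only [this, zpow_neg_one]
    rw [circleIntegral.integral_sub_center_inv _ hr.ne']; ring
  · rw [circleIntegral.integral_sub_zpow_of_ne (by omega), mul_zero, mul_zero]

/-- After the substitution `ζ̄ = r² / ζ` there are two simple poles, `z` and the reflection `ρ = r²
/ w̄`, with opposite residues. The first is inside when `|z| < r`, the second when `r < |w|`;
`|z||w| ≠ r²` keeps them distinct. -/
lemma circleIntegral_double_pole {r : ℝ} (hr : 0 < r) {z w : ℂ} (hw : w ≠ 0) (hz : ‖z‖ ≠ r)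
    (hwr : ‖w‖ ≠ r) (hzw : ‖z‖ * ‖w‖ ≠ r ^ 2) :
    (∮ ζ in C(0, r), 1 / ((ζ - z) * (starRingEnd ℂ w - starRingEnd ℂ ζ)) / ζ) =
      2 * Real.pi * Complex.I * (((if ‖z‖ < r then 1 else 0) - (if r ≤ ‖w‖ then 1 else 0)) /
        (starRingEnd ℂ w * z - (r : ℂ) ^ 2)) := by
  have hw' : starRingEnd ℂ w ≠ 0 := by simpa using hw
  have hw1 : 0 < ‖w‖ := norm_pos_iff.2 hw
  set ρ : ℂ := (r : ℂ) ^ 2 / starRingEnd ℂ w with hρ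
  have hρn : ‖ρ‖ = r ^ 2 / ‖w‖ := by
    rw [hρ, norm_div, norm_pow, Complex.norm_conj, Complex.norm_real, Real.norm_of_nonneg hr.le]
  have hρlt : ‖ρ‖ < r ↔ r ≤ ‖w‖ := by
    rw [hρn, div_lt_iff₀ hw1, sq]
    constructor
    · intro h; exact (lt_of_mul_lt_mul_left h hr.le).le
    · intro h; exact mul_lt_mul_of_pos_left (lt_of_le_of_ne h (Ne.symm hwr)) hr
  have hρr : ‖ρ‖ ≠ r := by
    rw [hρn, Ne, div_eq_iff hw1.ne', sq]
    intro h; exact hwr (mul_left_cancel₀ hr.ne' h).symm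
  have hzρ : z - ρ ≠ 0 := by
    intro h
    have := congrArg norm (sub_eq_zero.1 h)
    rw [hρn, eq_div_iff hw1.ne'] at this
    exact hzw this
  have hden : starRingEnd ℂ w * z - (r : ℂ) ^ 2 = starRingEnd ℂ w * (z - ρ) := by
    rw [hρ]; field_simp
  have e1 : (∮ ζ in C(0, r), 1 / ((ζ - z) * (starRingEnd ℂ w - starRingEnd ℂ ζ)) / ζ) =
      ∮ ζ in C(0, r), (starRingEnd ℂ w * (z - ρ))⁻¹ * ((ζ - z)⁻¹ - (ζ - ρ)⁻¹) := by
    refine circleIntegral.integral_congr hr.le fun ζ hζ => ?_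
    obtain ⟨h0, hc⟩ := sphere_conj hr hζ
    have hn : ‖ζ‖ = r := by simpa using hζ
    have h1 : ζ - z ≠ 0 := sub_ne_zero.2 fun h => hz (h ▸ hn)
    have h2 : ζ - ρ ≠ 0 := sub_ne_zero.2 fun h => hρr (h ▸ hn)
    simp only [hc]
    rw [inv_sub_inv h1 h2, div_div, mul_assoc (ζ - z), sub_mul _ _ ζ, div_mul_cancel₀ _ h0,
      show (r : ℂ) ^ 2 = starRingEnd ℂ w * ρ by rw [hρ]; field_simp, ← mul_sub]
    field_simp
    ring
  have ci : ∀ u : ℂ, ‖u‖ ≠ r → CircleIntegrable (fun ζ => (ζ - u)⁻¹) 0 r := fun u hu => by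
    rw [circleIntegrable_sub_inv_iff]
    right
    simpa [abs_of_pos hr] using hu
  rw [e1, circleIntegral.integral_const_mul, circleIntegral.integral_sub (ci z hz) (ci ρ hρr),
    circleIntegral_sub_inv hr hz, circleIntegral_sub_inv hr hρr, hden]
  simp only [hρlt]
  ring

/-! ### Explicit integrals over the disc -/

lemma ae_norm_ne (t : ℝ) : ∀ᵐ ζ : ℂ, ‖ζ‖ ≠ t := by
  have : {ζ : ℂ | ¬‖ζ‖ ≠ t} = sphere 0 t := by ext; simp
  rw [ae_iff, this]
  exact Measure.addHaar_sphere volume 0 t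

@[fun_prop]
lemma measurable_conj_comp {α : Type*} [MeasurableSpace α] {f : α → ℂ} (hf : Measurable f) :
    Measurable fun x => starRingEnd ℂ (f x) :=
  Complex.continuous_conj.measurable.comp hf

lemma norm_inv_conj_sub (ζ z : ℂ) : ‖(starRingEnd ℂ ζ - starRingEnd ℂ z)⁻¹‖ = ‖ζ - z‖⁻¹ := by
  rw [← map_sub, norm_inv, Complex.norm_conj]

lemma integrableOn_of_norm_le_inv {R C : ℝ} {a : ℂ} {g : ℂ → ℂ}
    (hg : AEStronglyMeasurable g (volume.restrict (closedBall 0 R)))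
    (h : ∀ ζ ∈ closedBall (0 : ℂ) R, ‖g ζ‖ ≤ C * ‖ζ - a‖⁻¹) :
    IntegrableOn g (closedBall 0 R) :=
  Integrable.mono' ((integrableOn_norm_sub_inv R a).const_mul C) hg
    ((ae_restrict_iff' measurableSet_closedBall).2 (Filter.Eventually.of_forall h))

lemma integrableOn_continuous_div_conj_sub (R : ℝ) (a : ℂ) {g : ℂ → ℂ} (hg : Continuous g) :
    IntegrableOn (fun ζ => g ζ / (starRingEnd ℂ ζ - starRingEnd ℂ a)) (closedBall 0 R) := by
  obtain ⟨C, hC⟩ := (isCompact_closedBall (0 : ℂ) R).exists_bound_of_continuousOn hg.continuousOn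
  refine integrableOn_of_norm_le_inv (C := C) (a := a)
    (Measurable.aestronglyMeasurable (by fun_prop)) fun ζ hζ => ?_
  rw [div_eq_mul_inv, norm_mul, norm_inv_conj_sub]
  gcongr
  exact hC ζ hζ

lemma integrableOn_continuous_div_sub (R : ℝ) (a : ℂ) {g : ℂ → ℂ} (hg : Continuous g) :
    IntegrableOn (fun ζ => g ζ / (ζ - a)) (closedBall 0 R) := by
  obtain ⟨C, hC⟩ := (isCompact_closedBall (0 : ℂ) R).exists_bound_of_continuousOn hg.continuousOn
  refine integrableOn_of_norm_le_inv (C := C) (a := a)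
    (Measurable.aestronglyMeasurable (by fun_prop)) fun ζ hζ => ?_
  rw [div_eq_mul_inv, norm_mul, norm_inv]
  gcongr
  exact hC ζ hζ

lemma intervalIntegral_ite_le {R t : ℝ} (h0 : 0 ≤ t) (hR : t ≤ R) (F : ℝ → ℂ) :
    (∫ r in (0 : ℝ)..R, if r ≤ t then F r else 0) = ∫ r in (0 : ℝ)..t, F r := by
  rw [intervalIntegral.integral_of_le (h0.trans hR), intervalIntegral.integral_of_le h0]
  have : (fun r => if r ≤ t then F r else 0) = (Iic t).indicator F := by
    funext r; simp [indicator]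
  rw [this, setIntegral_indicator measurableSet_Iic, ← Ioi_inter_Iic, inter_assoc,
    Iic_inter_Iic, min_eq_right hR, Ioi_inter_Iic]

/-- Only radii below `|z|` contribute, hence the value does not depend on `R`. The radial integral
gives `|z| ^ (2 * p + 2) = (z * z̄) ^ (p + 1)`, which cancels the power of `z̄` in the residue. -/
lemma setIntegral_pow_div_conj_sub {R : ℝ} (p : ℕ) {z : ℂ}
    (hz : z ∈ closedBall (0 : ℂ) R) :
    ∫ ζ in closedBall (0 : ℂ) R, ζ ^ p / (starRingEnd ℂ ζ - starRingEnd ℂ z) =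
      -(Real.pi * z ^ (p + 1) / (p + 1)) := by
  have hz' : ‖z‖ ≤ R := by simpa using hz
  have hp : ((p : ℂ) + 1) ≠ 0 := Nat.cast_add_one_ne_zero p
  rw [setIntegral_closedBall_eq ((norm_nonneg z).trans hz')
    (integrableOn_continuous_div_conj_sub R z (by fun_prop))
    (c := fun r => if r ≤ ‖z‖ then -((r : ℂ) ^ (2 * p) / (starRingEnd ℂ z) ^ (p + 1)) else 0)]
  · have e : ∀ r : ℝ, (r : ℂ) * (if r ≤ ‖z‖ then -((r : ℂ) ^ (2 * p) / (starRingEnd ℂ z) ^ (p + 1))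
        else 0) = if r ≤ ‖z‖ then
          -((starRingEnd ℂ z) ^ (p + 1))⁻¹ * ((r ^ (2 * p + 1) : ℝ) : ℂ) else 0 := fun r => by
      split_ifs <;> push_cast <;> ring
    simp only [e]
    rw [intervalIntegral_ite_le (norm_nonneg z) hz', intervalIntegral.integral_const_mul,
      intervalIntegral.integral_ofReal, integral_pow]
    push_cast
    by_cases h0 : z = 0
    · simp [h0]
    have h1 : starRingEnd ℂ z ≠ 0 := by simpa using h0
    have h2 : (‖z‖ : ℂ) ^ (2 * p + 1 + 1) = z ^ (p + 1) * starRingEnd ℂ z ^ (p + 1) := by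
      rw [← mul_pow, Complex.mul_conj, Complex.normSq_eq_norm_sq]
      push_cast
      rw [← pow_mul]; ring
    have h3 : (2 * (p : ℂ) + 1 + 1) = 2 * (p + 1) := by ring
    rw [h2, h3, zero_pow (by omega), sub_zero]
    field_simp
  · filter_upwards [compl_mem_ae_iff.2 (by simp : volume ({‖z‖} : Set ℝ) = 0)] with r hr h0 _
    exact circleIntegral_pow_div_conj_sub p h0 (Ne.symm hr)

lemma setIntegral_conj_pow_mul_pow {R : ℝ} (hR : 0 ≤ R) (p q : ℕ) :
    ∫ ζ in closedBall (0 : ℂ) R, starRingEnd ℂ ζ ^ p * ζ ^ q =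
      if p = q then Real.pi * (R : ℂ) ^ (2 * p + 2) / (p + 1) else 0 := by
  have hp : ((p : ℂ) + 1) ≠ 0 := Nat.cast_add_one_ne_zero p
  rw [setIntegral_closedBall_eq hR
    ((by fun_prop : Continuous fun ζ : ℂ => starRingEnd ℂ ζ ^ p * ζ ^ q).continuousOn.integrableOn_compact
      (isCompact_closedBall _ _))
    (c := fun r => if p = q then (r : ℂ) ^ (2 * p) else 0)
    (Filter.Eventually.of_forall fun r h0 _ => circleIntegral_conj_pow_mul_pow p q h0)]
  split_ifs with h
  · have e : ∀ r : ℝ, (r : ℂ) * (r : ℂ) ^ (2 * p) = ((r ^ (2 * p + 1) : ℝ) : ℂ) := fun r => by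
      push_cast; ring
    simp only [e, intervalIntegral.integral_ofReal, integral_pow]
    push_cast
    have h3 : (2 * (p : ℂ) + 1 + 1) = 2 * (p + 1) := by ring
    rw [h3, zero_pow (by omega), sub_zero]
    field_simp
  · simp

lemma setIntegral_conj_pow_div_sub {R : ℝ} (p : ℕ) {z : ℂ}
    (hz : z ∈ closedBall (0 : ℂ) R) :
    ∫ ζ in closedBall (0 : ℂ) R, starRingEnd ℂ ζ ^ p / (ζ - z) =
      -(Real.pi * starRingEnd ℂ z ^ (p + 1) / (p + 1)) := by
  have := congrArg (starRingEnd ℂ) (setIntegral_pow_div_conj_sub p hz)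
  rw [← integral_conj] at this
  simpa using this

lemma pow_div_sub_eq (z ζ : ℂ) (h : ζ ≠ z) (q : ℕ) :
    ζ ^ q / (ζ - z) = z ^ q * (1 / (ζ - z)) + ∑ i ∈ Finset.range q, ζ ^ i * z ^ (q - 1 - i) := by
  have h' : ζ - z ≠ 0 := sub_ne_zero.2 h
  have := geom_sum₂_mul ζ z q
  rw [eq_comm, ← div_eq_iff h'] at this
  rw [← this]; field_simp; ring

/-- Dividing `ζ ^ q` by `ζ - z` leaves a pure pole and a geometric sum. Angular orthogonality keeps
only the term `i = p` of that sum, which is present exactly when `p + 1 ≤ q`; this is the origin of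
the restriction `p ≤ q` in `C2`. -/
lemma setIntegral_conj_pow_mul_pow_div_sub {R : ℝ} (p q : ℕ) {z : ℂ}
    (hz : z ∈ closedBall (0 : ℂ) R) :
    ∫ ζ in closedBall (0 : ℂ) R, starRingEnd ℂ ζ ^ p * ζ ^ q / (ζ - z) =
      Real.pi / (p + 1) * ((if p + 1 ≤ q then (R : ℂ) ^ (2 * (p + 1)) * z ^ (q - (p + 1)) else 0) -
        starRingEnd ℂ z ^ (p + 1) * z ^ q) := by
  have hR : 0 ≤ R := (norm_nonneg z).trans (by simpa using hz)
  have hp : ((p : ℂ) + 1) ≠ 0 := Nat.cast_add_one_ne_zero p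
  have e : ∫ ζ in closedBall (0 : ℂ) R, starRingEnd ℂ ζ ^ p * ζ ^ q / (ζ - z) =
      ∫ ζ in closedBall (0 : ℂ) R, (z ^ q * (starRingEnd ℂ ζ ^ p / (ζ - z)) +
        ∑ i ∈ Finset.range q, z ^ (q - 1 - i) * (starRingEnd ℂ ζ ^ p * ζ ^ i)) := by
    refine integral_congr_ae (ae_restrict_of_ae ?_)
    filter_upwards [ae_ne z] with ζ h
    rw [mul_div_assoc, pow_div_sub_eq z ζ h, mul_add, Finset.mul_sum]
    congr 1
    · ring
    · exact Finset.sum_congr rfl fun i _ => by ring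
  have hi : ∀ i : ℕ, IntegrableOn (fun ζ : ℂ => z ^ (q - 1 - i) * (starRingEnd ℂ ζ ^ p * ζ ^ i))
      (closedBall 0 R) := fun i =>
    (by fun_prop : Continuous fun ζ : ℂ => z ^ (q - 1 - i) * (starRingEnd ℂ ζ ^ p * ζ ^ i)).continuousOn.integrableOn_compact
      (isCompact_closedBall _ _)
  rw [e, integral_add ((integrableOn_continuous_div_sub R z (by fun_prop)).const_mul _)
    (integrable_finsetSum _ fun i _ => hi i), integral_finsetSum _ fun i _ => hi i]
  simp only [integral_const_mul, setIntegral_conj_pow_div_sub p hz,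
    setIntegral_conj_pow_mul_pow hR]
  simp only [mul_ite, mul_zero, Finset.sum_ite_eq, Finset.mem_range, Nat.lt_iff_add_one_le]
  split_ifs
  · rw [show q - 1 - p = q - (p + 1) by omega]; field_simp; ring
  · field_simp; ring

/-- For distinct poles, `|z - w| ≤ |ζ - z| + |ζ - w|` bounds the product of the two inverse
distances by their sum divided by `|z - w|`. -/
lemma integrableOn_double_pole (R : ℝ) {z w : ℂ} (hzw : z ≠ w) :
    IntegrableOn (fun ζ => 1 / ((ζ - z) * (starRingEnd ℂ w - starRingEnd ℂ ζ)))
      (closedBall 0 R) := by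
  refine Integrable.mono' (((integrableOn_norm_sub_inv R z).add
    (integrableOn_norm_sub_inv R w)).const_mul ‖z - w‖⁻¹)
    (Measurable.aestronglyMeasurable (by fun_prop)) (ae_restrict_of_ae ?_)
  filter_upwards [ae_ne z, ae_ne w] with ζ h1 h2
  have hx : 0 < ‖ζ - z‖ := norm_pos_iff.2 (sub_ne_zero.2 h1)
  have hy : 0 < ‖ζ - w‖ := norm_pos_iff.2 (sub_ne_zero.2 h2)
  have hd : 0 < ‖z - w‖ := norm_pos_iff.2 (sub_ne_zero.2 hzw)
  have hle : ‖z - w‖ ≤ ‖ζ - z‖ + ‖ζ - w‖ := by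
    calc ‖z - w‖ = ‖(ζ - w) - (ζ - z)‖ := by congr 1; ring
      _ ≤ _ := by rw [add_comm]; exact norm_sub_le _ _
  rw [norm_div, norm_mul, norm_one, ← map_sub, Complex.norm_conj, norm_sub_rev w ζ, Pi.add_apply,
    div_le_iff₀ (by positivity)]
  have : ‖z - w‖⁻¹ * (‖ζ - z‖⁻¹ + ‖ζ - w‖⁻¹) * (‖ζ - z‖ * ‖ζ - w‖) =
      (‖ζ - z‖ + ‖ζ - w‖) / ‖z - w‖ := by field_simp; ring
  rw [this, le_div_iff₀ hd]; linarith

lemma intervalIntegral_radial_log {a b : ℝ} {w : ℂ} (hab : a ≤ b) (ha : 0 < a) (h : ‖w‖ < a ^ 2) :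
    ∫ r in a..b, (r : ℂ) / (w - (r : ℂ) ^ 2) =
      (Complex.log ((a : ℂ) ^ 2 - w) - Complex.log ((b : ℂ) ^ 2 - w)) / 2 := by
  have hs : ∀ r ∈ uIcc a b, (r : ℂ) ^ 2 - w ∈ Complex.slitPlane := fun r hr => by
    rw [uIcc_of_le hab] at hr
    left
    have := (abs_le.1 (Complex.abs_re_le_norm w)).2
    have h2 : ((r : ℂ) ^ 2 - w).re = r ^ 2 - w.re := by
      rw [Complex.sub_re, ← Complex.ofReal_pow, Complex.ofReal_re]
    rw [h2]
    nlinarith [hr.1]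
  rw [intervalIntegral.integral_eq_sub_of_hasDerivAt
    (f := fun r : ℝ => -Complex.log ((r : ℂ) ^ 2 - w) / 2)]
  · ring
  · intro r hr
    have h1 : HasDerivAt (fun r : ℝ => (r : ℂ) ^ 2 - w) (2 * (r : ℂ)) r := by
      have := ((Complex.ofRealCLM.hasDerivAt (x := r)).pow 2).sub_const w
      simpa using this
    refine HasDerivAt.congr_deriv ((h1.clog_real (hs r hr)).neg.div_const 2) ?_
    have h0 := Complex.slitPlane_ne_zero (hs r hr)
    have h0' : w - (r : ℂ) ^ 2 ≠ 0 := by rw [← neg_ne_zero, neg_sub]; exact h0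
    field_simp
    ring
  · refine ContinuousOn.intervalIntegrable (ContinuousOn.div (by fun_prop) (by fun_prop) fun r hr => ?_)
    rw [← neg_ne_zero, neg_sub]
    exact Complex.slitPlane_ne_zero (hs r hr)

/-- The integrand is that of `intervalIntegral_radial_log`, but here `r² < |w|`, so the
antiderivative is normalised as `log (1 - r² / w)`. In both regimes the argument of the logarithm
stays in the right half plane and no branch is crossed. -/
lemma intervalIntegral_radial_log_zero {b : ℝ} {w : ℂ} (hb : 0 ≤ b) (h : b ^ 2 < ‖w‖) :
    ∫ r in (0 : ℝ)..b, (r : ℂ) / (w - (r : ℂ) ^ 2) =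
      -Complex.log (1 - (b : ℂ) ^ 2 / w) / 2 := by
  have hw : w ≠ 0 := norm_pos_iff.1 (lt_of_le_of_lt (sq_nonneg b) h)
  have hs : ∀ r ∈ uIcc 0 b, 1 - (r : ℂ) ^ 2 / w ∈ Complex.slitPlane := fun r hr => by
    rw [uIcc_of_le hb] at hr
    left
    have h1 := (abs_le.1 (Complex.abs_re_le_norm ((r : ℂ) ^ 2 / w))).2
    have h2 : ‖(r : ℂ) ^ 2 / w‖ < 1 := by
      rw [norm_div, div_lt_one (norm_pos_iff.2 hw), norm_pow, Complex.norm_real,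
        Real.norm_of_nonneg hr.1]
      nlinarith [hr.1, hr.2]
    rw [Complex.sub_re, Complex.one_re]
    linarith
  have hne : ∀ r ∈ uIcc 0 b, w - (r : ℂ) ^ 2 ≠ 0 := fun r hr h0 => by
    apply Complex.slitPlane_ne_zero (hs r hr)
    rw [← sub_eq_zero.1 h0, div_self hw, sub_self]
  rw [intervalIntegral.integral_eq_sub_of_hasDerivAt
    (f := fun r : ℝ => -Complex.log (1 - (r : ℂ) ^ 2 / w) / 2)]
  · simp
  · intro r hr
    have h1 : HasDerivAt (fun r : ℝ => 1 - (r : ℂ) ^ 2 / w) (-(2 * (r : ℂ) / w)) r := by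
      have := (((Complex.ofRealCLM.hasDerivAt (x := r)).pow 2).div_const w).const_sub 1
      simpa using this
    refine HasDerivAt.congr_deriv ((h1.clog_real (hs r hr)).neg.div_const 2) ?_
    have h0 := Complex.slitPlane_ne_zero (hs r hr)
    have h0' := hne r hr
    have : 1 - (r : ℂ) ^ 2 / w = (w - (r : ℂ) ^ 2) / w := by field_simp
    rw [this]
    field_simp
  · exact ContinuousOn.intervalIntegrable (ContinuousOn.div (by fun_prop) (by fun_prop) hne)

lemma log_mul_of_re_pos {x y : ℂ} (hx : 0 < x.re) (hy : 0 < y.re) :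
    Complex.log (x * y) = Complex.log x + Complex.log y := by
  have h1 := Complex.abs_arg_lt_pi_div_two_iff.2 (Or.inl hx)
  have h2 := Complex.abs_arg_lt_pi_div_two_iff.2 (Or.inl hy)
  rw [abs_lt] at h1 h2
  refine Complex.log_mul ?_ ?_ ⟨by linarith, by linarith⟩
  · rintro rfl; simp at hx
  · rintro rfl; simp at hy

/-- The two residues cancel on the annulus `|z| < r < |w|`. What remains is the radial integral
beyond `|w|` minus the one below `|z|`, each a logarithm, and these combine through `(|w|² - w̄z)(1
- |z|² / (w̄z)) = |z - w|²`. -/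
lemma setIntegral_double_pole_of_norm_lt {R : ℝ} {z w : ℂ} (hzw : ‖z‖ < ‖w‖) (hw : ‖w‖ ≤ R) :
    ∫ ζ in closedBall (0 : ℂ) R, 1 / ((ζ - z) * (starRingEnd ℂ w - starRingEnd ℂ ζ)) =
      -Real.pi * Complex.log (((R : ℂ) ^ 2 - z * starRingEnd ℂ w) / ((‖z - w‖ ^ 2 : ℝ) : ℂ)) := by
  have hw1 : 0 < ‖w‖ := (norm_nonneg z).trans_lt hzw
  have hw0 : w ≠ 0 := norm_pos_iff.1 hw1
  have hw0' : starRingEnd ℂ w ≠ 0 := by simpa using hw0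
  have hne : z ≠ w := fun h => hzw.ne (congrArg norm h)
  have hR : 0 < R := hw1.trans_le hw
  set v : ℂ := starRingEnd ℂ w * z with hv
  have hvn : ‖v‖ = ‖w‖ * ‖z‖ := by rw [hv, norm_mul, Complex.norm_conj]
  have hvw : ‖v‖ < ‖w‖ ^ 2 := by rw [hvn, sq]; gcongr
  set F : ℝ → ℂ := fun r => (r : ℂ) / (v - (r : ℂ) ^ 2) with hF
  rw [setIntegral_closedBall_eq hR.le (integrableOn_double_pole R hne)
    (c := fun r => ((if ‖z‖ < r then 1 else 0) - (if r ≤ ‖w‖ then 1 else 0)) / (v - (r : ℂ) ^ 2))]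
  · have e : ∀ r : ℝ, (r : ℂ) * (((if ‖z‖ < r then 1 else 0) - (if r ≤ ‖w‖ then 1 else 0)) /
        (v - (r : ℂ) ^ 2)) = (Ioi ‖w‖).indicator F r - (Iic ‖z‖).indicator F r := fun r => by
      simp only [indicator, mem_Ioi, mem_Iic, hF]
      rcases le_or_gt r ‖z‖ with h1 | h1
      · simp [h1, not_lt.2 h1, (h1.trans hzw.le), not_lt.2 (h1.trans hzw.le)]; ring
      · rcases le_or_gt r ‖w‖ with h2 | h2
        · simp [h1, h2, not_lt.2 h2, not_le.2 h1]
        · simp [h1, h2, not_le.2 h1, not_le.2 h2]; ring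
    have i1 : IntegrableOn F (Ioc 0 R ∩ Ioi ‖w‖) := by
      refine IntegrableOn.mono_set (t := Icc ‖w‖ R) ?_ fun r hr => ⟨le_of_lt hr.2, hr.1.2⟩
      refine ContinuousOn.integrableOn_compact isCompact_Icc (ContinuousOn.div (by fun_prop)
        (by fun_prop) fun r hr h0 => ?_)
      have := congrArg norm (sub_eq_zero.1 h0)
      rw [norm_pow, Complex.norm_real, Real.norm_of_nonneg (hw1.le.trans hr.1)] at this
      nlinarith [hr.1]
    have s2 : Ioc 0 R ∩ Iic ‖z‖ = Ioc 0 ‖z‖ := by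
      rw [← Ioi_inter_Iic, inter_assoc, Iic_inter_Iic, min_eq_right (hzw.le.trans hw),
        Ioi_inter_Iic]
    have s1 : Ioc 0 R ∩ Ioi ‖w‖ = Ioc ‖w‖ R := by
      ext r; simp only [mem_inter_iff, mem_Ioc, mem_Ioi]
      constructor
      · rintro ⟨⟨_, h⟩, h'⟩; exact ⟨h', h⟩
      · rintro ⟨h', h⟩; exact ⟨⟨hw1.trans h', h⟩, h'⟩
    have i2 : IntegrableOn F (Ioc 0 R ∩ Iic ‖z‖) := by
      rw [s2]
      rcases eq_or_ne z 0 with rfl | hz0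
      · simp
      have hz1 : 0 < ‖z‖ := norm_pos_iff.2 hz0
      refine IntegrableOn.mono_set (t := Icc 0 ‖z‖) ?_ Ioc_subset_Icc_self
      refine ContinuousOn.integrableOn_compact isCompact_Icc (ContinuousOn.div (by fun_prop)
        (by fun_prop) fun r hr h0 => ?_)
      have := congrArg norm (sub_eq_zero.1 h0)
      rw [norm_pow, Complex.norm_real, Real.norm_of_nonneg hr.1, hvn] at this
      nlinarith [hr.1, hr.2]
    rw [intervalIntegral.integral_of_le hR.le]
    simp only [e]
    rw [integral_sub ((integrable_indicator_iff measurableSet_Ioi).2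
        (by rwa [IntegrableOn, Measure.restrict_restrict measurableSet_Ioi, inter_comm]))
      ((integrable_indicator_iff measurableSet_Iic).2
        (by rwa [IntegrableOn, Measure.restrict_restrict measurableSet_Iic, inter_comm])),
      setIntegral_indicator measurableSet_Ioi, setIntegral_indicator measurableSet_Iic, s1, s2,
      ← intervalIntegral.integral_of_le hw, ← intervalIntegral.integral_of_le (norm_nonneg z),
      intervalIntegral_radial_log hw hw1 hvw]
    have h3 : ∫ r in (0 : ℝ)..‖z‖, F r =
        -Complex.log (1 - (‖z‖ : ℂ) ^ 2 / v) / 2 := by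
      rcases eq_or_ne z 0 with rfl | hz0
      · simp
      · have hz1 : 0 < ‖z‖ := norm_pos_iff.2 hz0
        exact intervalIntegral_radial_log_zero (norm_nonneg z) (by rw [hvn]; nlinarith)
    rw [h3]
    -- For `z = 0` also `v = 0`; division by zero returns `0`, so the left side is `1`, the correct
    -- value.
    have e1 : 1 - (‖z‖ : ℂ) ^ 2 / v = (starRingEnd ℂ (w - z)) / starRingEnd ℂ w := by
      rcases eq_or_ne z 0 with rfl | hz0
      · simp [hw0]
      · have : (‖z‖ : ℂ) ^ 2 = z * starRingEnd ℂ z := by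
          rw [Complex.mul_conj, Complex.normSq_eq_norm_sq]; push_cast; rfl
        rw [this, hv, map_sub]; field_simp
    have e2 : (‖w‖ : ℂ) ^ 2 - v = starRingEnd ℂ w * (w - z) := by
      have : (‖w‖ : ℂ) ^ 2 = w * starRingEnd ℂ w := by
        rw [Complex.mul_conj, Complex.normSq_eq_norm_sq]; push_cast; rfl
      rw [this, hv]; ring
    have e3 : ((‖w‖ : ℂ) ^ 2 - v) * (1 - (‖z‖ : ℂ) ^ 2 / v) = ((‖z - w‖ ^ 2 : ℝ) : ℂ) := by
      rw [e1, e2, mul_assoc, mul_div_assoc', mul_div_assoc', mul_div_cancel_left₀ _ hw0',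
        Complex.mul_conj, Complex.normSq_eq_norm_sq, norm_sub_rev]
    have hvre := (abs_le.1 (Complex.abs_re_le_norm v)).2
    have p1 : 0 < ((‖w‖ : ℂ) ^ 2 - v).re := by
      rw [Complex.sub_re, ← Complex.ofReal_pow, Complex.ofReal_re]; linarith
    have p2 : 0 < (1 - (‖z‖ : ℂ) ^ 2 / v).re := by
      have h1 := (abs_le.1 (Complex.abs_re_le_norm ((‖z‖ : ℂ) ^ 2 / v))).2
      have h2 : ‖(‖z‖ : ℂ) ^ 2 / v‖ < 1 := by
        rcases eq_or_ne z 0 with rfl | hz0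
        · simp
        · have hz1 : 0 < ‖z‖ := norm_pos_iff.2 hz0
          rw [norm_div, hvn, div_lt_one (by positivity), norm_pow, Complex.norm_real, norm_norm]
          nlinarith
      rw [Complex.sub_re, Complex.one_re]; linarith
    have p3 : 0 < ((R : ℂ) ^ 2 - v).re := by
      rw [Complex.sub_re, ← Complex.ofReal_pow, Complex.ofReal_re]
      nlinarith
    have hd : 0 < ‖z - w‖ ^ 2 := by
      have : 0 < ‖z - w‖ := norm_pos_iff.2 (sub_ne_zero.2 hne)
      positivity
    have hd' : 0 < (((‖z - w‖ ^ 2)⁻¹ : ℝ) : ℂ).re := by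
      rw [Complex.ofReal_re]; positivity
    -- All factors have positive real part, so the principal logarithm is additive on them.
    have l1 := log_mul_of_re_pos p1 p2
    rw [e3] at l1
    have l2 := log_mul_of_re_pos p3 hd'
    have l3 : Complex.log (((‖z - w‖ ^ 2)⁻¹ : ℝ) : ℂ) = -Complex.log ((‖z - w‖ ^ 2 : ℝ) : ℂ) := by
      rw [← Complex.ofReal_log (by positivity), ← Complex.ofReal_log (by positivity), Real.log_inv]
      push_cast; rfl
    rw [mul_comm z, ← hv, div_eq_mul_inv (_ - v), ← Complex.ofReal_inv, l2, l3, l1]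
    ring
  · have hzero : ∀ t : ℝ, ∀ᵐ r : ℝ, r ≠ t := fun t =>
      compl_mem_ae_iff.2 (by simp : volume ({t} : Set ℝ) = 0)
    -- The excluded radii are those where a pole lies on the circle and the one where the reflection
    -- of `w` coincides in modulus with `z`.
    filter_upwards [hzero ‖z‖, hzero ‖w‖, hzero (Real.sqrt (‖z‖ * ‖w‖))] with r h1 h2 h3 h0 _
    refine circleIntegral_double_pole h0 hw0 (Ne.symm h1) (Ne.symm h2) fun h => h3 ?_
    rw [h, Real.sqrt_sq h0.le]

/-- The Green-type kernel of the disc as an area integral. -/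
lemma setIntegral_double_pole {R : ℝ} {z w : ℂ} (hzw : ‖z‖ ≠ ‖w‖) (hz : ‖z‖ ≤ R) (hw : ‖w‖ ≤ R) :
    ∫ ζ in closedBall (0 : ℂ) R, 1 / ((ζ - z) * (starRingEnd ℂ w - starRingEnd ℂ ζ)) =
      -Real.pi * Complex.log (((R : ℂ) ^ 2 - z * starRingEnd ℂ w) / ((‖z - w‖ ^ 2 : ℝ) : ℂ)) := by
  rcases hzw.lt_or_gt with h | h
  · exact setIntegral_double_pole_of_norm_lt h hw
  -- Conjugation exchanges the roles of `z` and `w`; it commutes with the principal logarithm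
  -- because the argument avoids the negative axis.
  · have key := congrArg (starRingEnd ℂ) (setIntegral_double_pole_of_norm_lt h hz)
    rw [← integral_conj, map_mul, map_neg, Complex.conj_ofReal, ← Complex.log_conj] at key
    · rw [map_div₀, map_sub, map_mul, Complex.conj_conj, map_pow, Complex.conj_ofReal,
        Complex.conj_ofReal, norm_sub_rev w z, mul_comm _ z] at key
      rw [← key]
      refine integral_congr_ae (Filter.Eventually.of_forall fun ζ => ?_)
      simp only [map_div₀, map_one, map_mul, map_sub, Complex.conj_conj]
      congr 1; ring
    · have hd : 0 < ‖w - z‖ := norm_pos_iff.2 (sub_ne_zero.2 fun h' => hzw (by rw [h']))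
      have hv : ‖w * starRingEnd ℂ z‖ < R ^ 2 := by
        rw [norm_mul, Complex.norm_conj]
        nlinarith [norm_nonneg w, norm_nonneg z]
      have hvre := (abs_le.1 (Complex.abs_re_le_norm (w * starRingEnd ℂ z))).2
      refine Complex.slitPlane_arg_ne_pi (Or.inl ?_)
      rw [div_eq_mul_inv, ← Complex.ofReal_inv, mul_comm, Complex.re_ofReal_mul, Complex.sub_re,
        ← Complex.ofReal_pow, Complex.ofReal_re]
      have : 0 < R ^ 2 - (w * starRingEnd ℂ z).re := by linarith
      positivity

/-! ### The iterated Cauchy kernels -/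

/-- The kernel of `T^{m+1}` in one variable. -/
def cauchyKernel (m : ℕ) (z ζ : ℂ) : ℂ :=
  -(1 / (Real.pi : ℂ)) * ((starRingEnd ℂ z - starRingEnd ℂ ζ) ^ m / (m.factorial : ℂ) / (ζ - z))

/-- The kernel of `T̄^{k+1}` in one variable. -/
def conjCauchyKernel (k : ℕ) (z ζ : ℂ) : ℂ :=
  -(1 / (Real.pi : ℂ)) *
    ((z - ζ) ^ k / (k.factorial : ℂ) / (starRingEnd ℂ ζ - starRingEnd ℂ z))

lemma conj_cauchyKernel (m : ℕ) (z ζ : ℂ) :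
    starRingEnd ℂ (cauchyKernel m z ζ) = conjCauchyKernel m z ζ := by
  simp [cauchyKernel, conjCauchyKernel]

lemma sum_Icc_one_eq_sum_range {M : Type*} [AddCommMonoid M] (F : ℕ → M) (n : ℕ) :
    ∑ l ∈ Finset.Icc 1 n, F l = ∑ i ∈ Finset.range n, F (i + 1) := by
  induction n with
  | zero => simp
  | succ n ih => rw [Finset.sum_Icc_succ_top (by omega), ih, Finset.sum_range_succ]

lemma choose_div_succ (n i : ℕ) :
    (n.choose i : ℂ) / ((i : ℂ) + 1) = ((n + 1).choose (i + 1) : ℂ) / ((n : ℂ) + 1) := by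
  have h1 : ((i : ℂ) + 1) ≠ 0 := Nat.cast_add_one_ne_zero i
  have h2 : ((n : ℂ) + 1) ≠ 0 := Nat.cast_add_one_ne_zero n
  rw [div_eq_div_iff h1 h2]
  have := Nat.add_one_mul_choose_eq n i
  rw [mul_comm]
  exact_mod_cast this

/-- Pascal's rule for a truncated binomial expansion: multiplying by `a - b` is exact except at the
top index, where half of the new coefficient is missing. -/
lemma C1_partial_sum_succ (a b : ℂ) {n l : ℕ} (hl : l ≤ n) :
    ∑ j ∈ Finset.range (n + 1 - l + 1), ((n + 1).choose j : ℂ) * a ^ (n + 1 - l - j) * (-b) ^ j =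
      (a - b) * ∑ j ∈ Finset.range (n - l + 1), (n.choose j : ℂ) * a ^ (n - l - j) * (-b) ^ j +
        (n.choose (n + 1 - l) : ℂ) * (-b) ^ (n + 1 - l) := by
  obtain ⟨d, rfl⟩ := Nat.exists_eq_add_of_le hl
  have e1 : l + d + 1 - l = d + 1 := by omega
  have e2 : l + d - l = d := by omega
  rw [e1, e2, Finset.sum_range_succ' _ (d + 1)]
  simp only [Nat.choose_succ_succ, Nat.cast_add, add_mul, Finset.sum_add_distrib,
    Nat.choose_zero_right, Nat.cast_one, pow_zero, Nat.sub_zero]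
  have h1 : ∑ j ∈ Finset.range (d + 1), ((l + d).choose j : ℂ) * a ^ (d + 1 - (j + 1)) *
      (-b) ^ (j + 1) = -b * ∑ j ∈ Finset.range (d + 1), ((l + d).choose j : ℂ) * a ^ (d - j) *
      (-b) ^ j := by
    rw [Finset.mul_sum]
    refine Finset.sum_congr rfl fun j _ => ?_
    rw [show d + 1 - (j + 1) = d - j by omega]; ring
  have h2 : (∑ j ∈ Finset.range (d + 1), ((l + d).choose (j + 1) : ℂ) * a ^ (d + 1 - (j + 1)) *
      (-b) ^ (j + 1)) + a ^ (d + 1) =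
      a * (∑ j ∈ Finset.range (d + 1), ((l + d).choose j : ℂ) * a ^ (d - j) * (-b) ^ j) +
        ((l + d).choose (d + 1) : ℂ) * (-b) ^ (d + 1) := by
    have h3 := Finset.sum_range_succ' (fun j => ((l + d).choose j : ℂ) * a ^ (d + 1 - j) *
      (-b) ^ j) (d + 1)
    simp only [Nat.choose_zero_right, Nat.cast_one, pow_zero, Nat.sub_zero, mul_one, one_mul] at h3
    rw [← h3, Finset.sum_range_succ, Nat.sub_self, pow_zero, mul_one, Finset.mul_sum]
    congr 1
    refine Finset.sum_congr rfl fun j hj => ?_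
    rw [show d + 1 - j = d - j + 1 by have := Finset.mem_range.1 hj; omega]; ring
  rw [h1, one_mul, mul_one]
  linear_combination h2

/-- This recursion matches the step `w - b = (z - b) + (w - z)` in
`setIntegral_sub_pow_mul_double_pole`. The truncation errors sum to the expansion of `(b - b) ^ (n +
1) = 0` without its first term, which gives the closed form. -/
lemma C1_succ (a b : ℂ) (n : ℕ) :
    C1 a b (n + 2) = (a - b) * C1 a b (n + 1) + (-b) ^ (n + 1) / ((n : ℂ) + 1) := by
  have hn : ((n : ℂ) + 1) ≠ 0 := Nat.cast_add_one_ne_zero n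
  simp only [C1, show n + 2 - 1 = n + 1 by omega, Nat.add_sub_cancel]
  have key : ∀ l ∈ Finset.Icc 1 (n + 1), (-(b ^ l) / (l : ℂ)) *
      ∑ j ∈ Finset.range (n + 1 - l + 1), ((n + 1).choose j : ℂ) * a ^ (n + 1 - l - j) * (-b) ^ j =
      (if l ≤ n then (a - b) * ((-(b ^ l) / (l : ℂ)) *
        ∑ j ∈ Finset.range (n - l + 1), (n.choose j : ℂ) * a ^ (n - l - j) * (-b) ^ j) else 0) +
      (-(b ^ l) / (l : ℂ)) * ((n.choose (n + 1 - l) : ℂ) * (-b) ^ (n + 1 - l)) := by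
    intro l hl
    rw [Finset.mem_Icc] at hl
    split_ifs with h
    · rw [C1_partial_sum_succ a b h]; ring
    · have : l = n + 1 := by omega
      subst this
      simp
  rw [Finset.sum_congr rfl key, Finset.sum_add_distrib]
  congr 1
  · rw [Finset.sum_Icc_succ_top (by omega), if_neg (by omega), add_zero, Finset.mul_sum]
    refine Finset.sum_congr rfl fun l hl => ?_
    rw [if_pos (Finset.mem_Icc.1 hl).2]
  · rw [sum_Icc_one_eq_sum_range]
    have h0 := add_pow b (-b) (n + 1)
    rw [add_neg_cancel, zero_pow (by omega), Finset.sum_range_succ'] at h0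
    have h1 : ∀ i ∈ Finset.range (n + 1), (-(b ^ (i + 1)) / ((i + 1 : ℕ) : ℂ)) *
        ((n.choose (n + 1 - (i + 1)) : ℂ) * (-b) ^ (n + 1 - (i + 1))) =
        -((n : ℂ) + 1)⁻¹ *
          (b ^ (i + 1) * (-b) ^ (n + 1 - (i + 1)) * ((n + 1).choose (i + 1) : ℂ)) := by
      intro i hi
      have hi' := Finset.mem_range.1 hi
      rw [show n + 1 - (i + 1) = n - i by omega, Nat.choose_symm (by omega)]
      have := choose_div_succ n i
      push_cast
      linear_combination (-(b ^ (i + 1)) * (-b) ^ (n - i)) * this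
    rw [Finset.sum_congr rfl h1, ← Finset.mul_sum]
    simp only [pow_zero, one_mul, Nat.sub_zero, Nat.choose_zero_right, Nat.cast_one, mul_one] at h0
    field_simp
    linear_combination h0

/-- Expand both powers and integrate monomials. The factor `1 / (p + 1)` is absorbed by
`choose_div_succ`, which raises `l` to `l + 1` and shifts `p` by one. -/
lemma setIntegral_conj_sub_pow_mul_sub_pow_div_sub {R : ℝ} (l k : ℕ) {z : ℂ}
    (hz : z ∈ closedBall (0 : ℂ) R) (b : ℂ) :
    ∫ w in closedBall (0 : ℂ) R, (starRingEnd ℂ w - starRingEnd ℂ b) ^ l * (w - b) ^ k / (w - z) =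
      Real.pi / (l + 1) * (C2 R z b (l + 1) (k + 1) -
        (starRingEnd ℂ z - starRingEnd ℂ b) ^ (l + 1) * (z - b) ^ k) := by
  set b' := starRingEnd ℂ b with hb'
  have hl : ((l : ℂ) + 1) ≠ 0 := Nat.cast_add_one_ne_zero l
  set c : ℕ → ℕ → ℂ := fun p q =>
    (l.choose p : ℂ) * (k.choose q : ℂ) * (-b') ^ (l - p) * (-b) ^ (k - q) with hc
  have e1 : ∀ w : ℂ, (starRingEnd ℂ w - b') ^ l * (w - b) ^ k / (w - z) =
      ∑ p ∈ Finset.range (l + 1), ∑ q ∈ Finset.range (k + 1),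
        c p q * (starRingEnd ℂ w ^ p * w ^ q / (w - z)) := fun w => by
    rw [sub_eq_add_neg, add_pow, sub_eq_add_neg w b, add_pow, Finset.sum_mul_sum, Finset.sum_div]
    refine Finset.sum_congr rfl fun p _ => ?_
    rw [Finset.sum_div]
    refine Finset.sum_congr rfl fun q _ => ?_
    simp only [hc]; ring
  have hi : ∀ p q : ℕ, IntegrableOn (fun w => c p q * (starRingEnd ℂ w ^ p * w ^ q / (w - z)))
      (closedBall 0 R) := fun p q =>
    (integrableOn_continuous_div_sub R z (by fun_prop)).const_mul _
  simp only [e1]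
  rw [integral_finsetSum _ fun p _ => integrable_finsetSum _ fun q _ => hi p q]
  have e2 : ∀ p, ∫ w in closedBall (0 : ℂ) R, ∑ q ∈ Finset.range (k + 1),
      c p q * (starRingEnd ℂ w ^ p * w ^ q / (w - z)) = ∑ q ∈ Finset.range (k + 1),
      c p q * (Real.pi / (p + 1) * ((if p + 1 ≤ q then (R : ℂ) ^ (2 * (p + 1)) *
        z ^ (q - (p + 1)) else 0) - starRingEnd ℂ z ^ (p + 1) * z ^ q)) := fun p => by
    rw [integral_finsetSum _ fun q _ => hi p q]
    refine Finset.sum_congr rfl fun q _ => ?_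
    rw [integral_const_mul, setIntegral_conj_pow_mul_pow_div_sub p q hz]
  simp only [e2]
  have e3 : C2 R z b (l + 1) (k + 1) =
      ∑ p ∈ Finset.range (l + 2), ∑ q ∈ Finset.range (k + 1), ((l + 1).choose p : ℂ) *
        (k.choose q : ℂ) * (-b') ^ (l + 1 - p) * (-b) ^ (k - q) *
          (if p ≤ q then (R : ℂ) ^ (2 * p) * z ^ (q - p) else 0) := by
    simp only [C2, Nat.add_sub_cancel]
    refine Finset.sum_congr rfl fun p _ => ?_
    simp only [mul_ite, mul_zero]
    rw [← Finset.sum_filter]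
    refine Finset.sum_congr ?_ fun q _ => by ring
    ext q; simp only [Finset.mem_Icc, Finset.mem_filter, Finset.mem_range]; omega
  have e4 : (starRingEnd ℂ z - b') ^ (l + 1) * (z - b) ^ k =
      ∑ p ∈ Finset.range (l + 2), ∑ q ∈ Finset.range (k + 1), ((l + 1).choose p : ℂ) *
        (k.choose q : ℂ) * (-b') ^ (l + 1 - p) * (-b) ^ (k - q) *
          (starRingEnd ℂ z ^ p * z ^ q) := by
    rw [sub_eq_add_neg, add_pow, sub_eq_add_neg z b, add_pow, Finset.sum_mul_sum]
    refine Finset.sum_congr rfl fun p _ => Finset.sum_congr rfl fun q _ => by ring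
  rw [e3, e4, ← Finset.sum_sub_distrib]
  simp only [← Finset.sum_sub_distrib, ← mul_sub]
  -- The `p = 0` terms of `C2` and of the expanded power agree, so only shifted indices survive.
  rw [Finset.sum_range_succ' _ (l + 1)]
  simp only [Nat.zero_le, if_true, mul_zero, pow_zero, one_mul, Nat.sub_zero, sub_self,
    Finset.sum_const_zero, add_zero, Finset.mul_sum]
  refine Finset.sum_congr rfl fun p _ => Finset.sum_congr rfl fun q _ => ?_
  have := choose_div_succ l p
  simp only [hc, Nat.add_sub_add_right]
  linear_combination ((k.choose q : ℂ) * (-b') ^ (l - p) * (-b) ^ (k - q) * Real.pi *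
    ((if p + 1 ≤ q then (R : ℂ) ^ (2 * (p + 1)) * z ^ (q - (p + 1)) else 0) -
      starRingEnd ℂ z ^ (p + 1) * z ^ q)) * this

lemma C2_one (R : ℝ) (a b : ℂ) (l : ℕ) : C2 R a b (l + 1) 1 = (-(starRingEnd ℂ b)) ^ (l + 1) := by
  rw [C2, Finset.sum_range_succ', Finset.sum_eq_zero]
  · simp
  · intro p _
    rw [Finset.Icc_eq_empty (by omega), Finset.sum_empty]

lemma setIntegral_conj_sub_pow_div_sub {R : ℝ} (l : ℕ) {z : ℂ}
    (hz : z ∈ closedBall (0 : ℂ) R) (b : ℂ) :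
    ∫ w in closedBall (0 : ℂ) R, (starRingEnd ℂ w - starRingEnd ℂ b) ^ l / (w - z) =
      Real.pi / (l + 1) * ((-(starRingEnd ℂ b)) ^ (l + 1) -
        (starRingEnd ℂ z - starRingEnd ℂ b) ^ (l + 1)) := by
  have := setIntegral_conj_sub_pow_mul_sub_pow_div_sub l 0 hz b
  simpa [C2_one] using this

lemma setIntegral_sub_pow_div_conj_sub {R : ℝ} (l : ℕ) {z : ℂ}
    (hz : z ∈ closedBall (0 : ℂ) R) (b : ℂ) :
    ∫ w in closedBall (0 : ℂ) R, (w - b) ^ l / (starRingEnd ℂ w - starRingEnd ℂ z) =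
      Real.pi / (l + 1) * ((-b) ^ (l + 1) - (z - b) ^ (l + 1)) := by
  have := congrArg (starRingEnd ℂ) (setIntegral_conj_sub_pow_div_sub l hz b)
  rw [← integral_conj] at this
  simpa using this

/-- Composition of the Cauchy kernel with the kernel of an iterate. -/
lemma setIntegral_cauchyKernel_zero_mul {R : ℝ} (m : ℕ) {z ζ : ℂ}
    (hz : z ∈ closedBall (0 : ℂ) R) (hζ : ζ ∈ closedBall (0 : ℂ) R) (hne : ζ ≠ z) :
    ∫ w in closedBall (0 : ℂ) R, cauchyKernel 0 z w * cauchyKernel m w ζ =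
      cauchyKernel (m + 1) z ζ := by
  have hsub : ζ - z ≠ 0 := sub_ne_zero.2 hne
  have hπ : (Real.pi : ℂ) ≠ 0 := by exact_mod_cast Real.pi_ne_zero
  have hm : ((m : ℂ) + 1) ≠ 0 := Nat.cast_add_one_ne_zero m
  have hf : (m.factorial : ℂ) ≠ 0 := by exact_mod_cast m.factorial_ne_zero
  have e : ∫ w in closedBall (0 : ℂ) R, cauchyKernel 0 z w * cauchyKernel m w ζ =
      ∫ w in closedBall (0 : ℂ) R, (1 / ((Real.pi : ℂ) ^ 2 * m.factorial * (ζ - z))) *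
        -- Partial fractions in `w`; the terms `(-ζ̄) ^ (m + 1)` coming from the two integrals
        -- cancel, leaving only `(z̄ - ζ̄) ^ (m + 1)`.
        ((starRingEnd ℂ w - starRingEnd ℂ ζ) ^ m / (w - z) -
          (starRingEnd ℂ w - starRingEnd ℂ ζ) ^ m / (w - ζ)) := by
    refine integral_congr_ae (ae_restrict_of_ae ?_)
    filter_upwards [ae_ne z, ae_ne ζ] with w h1 h2
    have h1' : w - z ≠ 0 := sub_ne_zero.2 h1
    have h2' : w - ζ ≠ 0 := sub_ne_zero.2 h2
    have h3' : ζ - w ≠ 0 := sub_ne_zero.2 (Ne.symm h2)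
    simp only [cauchyKernel, pow_zero, Nat.factorial_zero, Nat.cast_one]
    rw [← neg_sub w ζ] at *
    field_simp
    ring
  rw [e, integral_const_mul, integral_sub (integrableOn_continuous_div_sub R z (by fun_prop))
    (integrableOn_continuous_div_sub R ζ (by fun_prop)), setIntegral_conj_sub_pow_div_sub m hz,
    setIntegral_conj_sub_pow_div_sub m hζ, sub_self, zero_pow (by omega), cauchyKernel,
    Nat.factorial_succ]
  push_cast
  field_simp
  ring

lemma setIntegral_conjCauchyKernel_zero_mul {R : ℝ} (m : ℕ) {z ζ : ℂ}
    (hz : z ∈ closedBall (0 : ℂ) R) (hζ : ζ ∈ closedBall (0 : ℂ) R) (hne : ζ ≠ z) :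
    ∫ w in closedBall (0 : ℂ) R, conjCauchyKernel 0 z w * conjCauchyKernel m w ζ =
      conjCauchyKernel (m + 1) z ζ := by
  simp only [← conj_cauchyKernel, ← map_mul]
  rw [integral_conj, setIntegral_cauchyKernel_zero_mul m hz hζ hne]

lemma integrableOn_continuous_mul_double_pole (R : ℝ) {z b : ℂ} (hzb : z ≠ b) {g : ℂ → ℂ}
    (hg : Continuous g) :
    IntegrableOn (fun w => g w * (1 / ((w - z) * (starRingEnd ℂ b - starRingEnd ℂ w))))
      (closedBall 0 R) :=
  (integrableOn_double_pole R hzb).continuousOn_mul hg.continuousOn (isCompact_closedBall _ _)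

lemma setIntegral_sub_pow_mul_double_pole {R : ℝ} (k : ℕ) {z b : ℂ} (hz : z ∈ closedBall (0 : ℂ) R)
    (hb : b ∈ closedBall (0 : ℂ) R) (hzb : ‖z‖ ≠ ‖b‖) :
    ∫ w in closedBall (0 : ℂ) R,
        (w - b) ^ k * (1 / ((w - z) * (starRingEnd ℂ b - starRingEnd ℂ w))) =
      -Real.pi * (C1 z b (k + 1) + (z - b) ^ k *
        Complex.log (((R : ℂ) ^ 2 - z * starRingEnd ℂ b) / ((‖z - b‖ ^ 2 : ℝ) : ℂ))) := by
  have hne : z ≠ b := fun h => hzb (congrArg norm h)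
  induction k with
  | zero =>
    simp only [pow_zero, one_mul]
    rw [setIntegral_double_pole hzb (by simpa using hz) (by simpa using hb)]
    simp [C1]
  | succ k ih =>
    -- Write one factor `w - b` as `(z - b) + (w - z)`: the first part is the induction hypothesis,
    -- the second cancels the pole at `z`.
    have e : ∫ w in closedBall (0 : ℂ) R,
        (w - b) ^ (k + 1) * (1 / ((w - z) * (starRingEnd ℂ b - starRingEnd ℂ w))) =
        ∫ w in closedBall (0 : ℂ) R, ((z - b) * ((w - b) ^ k *
          (1 / ((w - z) * (starRingEnd ℂ b - starRingEnd ℂ w)))) -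
          (w - b) ^ k / (starRingEnd ℂ w - starRingEnd ℂ b)) := by
      refine integral_congr_ae (ae_restrict_of_ae ?_)
      filter_upwards [ae_ne z, ae_ne b] with w h1 h2
      have h1' : w - z ≠ 0 := sub_ne_zero.2 h1
      have h2' : starRingEnd ℂ w - starRingEnd ℂ b ≠ 0 :=
        sub_ne_zero.2 ((starRingEnd ℂ).injective.ne h2)
      rw [← neg_sub (starRingEnd ℂ w)]
      field_simp
      ring
    have hk : ((k : ℂ) + 1) ≠ 0 := Nat.cast_add_one_ne_zero k
    rw [e, integral_sub ((integrableOn_continuous_mul_double_pole R hne (by fun_prop)).const_mul _)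
      (integrableOn_continuous_div_conj_sub R b (by fun_prop)), integral_const_mul, ih,
      setIntegral_sub_pow_div_conj_sub k hb, C1_succ, sub_self, zero_pow (by omega)]
    field_simp
    ring

/-- Composition of the kernels of the iterates of `T` and `T̄`. -/
lemma setIntegral_cauchyKernel_mul_conjCauchyKernel {R : ℝ} (m k : ℕ) {z b : ℂ}
    (hz : z ∈ closedBall (0 : ℂ) R) (hb : b ∈ closedBall (0 : ℂ) R) (hzb : ‖z‖ ≠ ‖b‖) :
    ∫ w in closedBall (0 : ℂ) R, cauchyKernel m z w * conjCauchyKernel k w b =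
      (-1) ^ (m + 1) / (Real.pi * m.factorial * k.factorial) * C3 R z b (m + 1) (k + 1) := by
  have hne : z ≠ b := fun h => hzb (congrArg norm h)
  have hπ : (Real.pi : ℂ) ≠ 0 := by exact_mod_cast Real.pi_ne_zero
  have hm : (m.factorial : ℂ) ≠ 0 := by exact_mod_cast m.factorial_ne_zero
  have hk : (k.factorial : ℂ) ≠ 0 := by exact_mod_cast k.factorial_ne_zero
  set z' := starRingEnd ℂ z with hz'
  set b' := starRingEnd ℂ b with hb'
  have e : ∫ w in closedBall (0 : ℂ) R, cauchyKernel m z w * conjCauchyKernel k w b =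
      ∫ w in closedBall (0 : ℂ) R, (1 / ((Real.pi : ℂ) ^ 2 * m.factorial * k.factorial)) *
        ((z' - b') ^ m * ((w - b) ^ k * (1 / ((w - z) * (b' - starRingEnd ℂ w)))) +
          ∑ l ∈ Finset.range m, (m.choose (l + 1) : ℂ) * (z' - b') ^ (m - (l + 1)) * (-1) ^ l *
            ((starRingEnd ℂ w - b') ^ l * (w - b) ^ k / (w - z))) := by
    refine integral_congr_ae (ae_restrict_of_ae ?_)
    filter_upwards [ae_ne z, ae_ne b] with w h1 h2
    have h1' : w - z ≠ 0 := sub_ne_zero.2 h1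
    have h2' : b' - starRingEnd ℂ w ≠ 0 :=
      sub_ne_zero.2 ((starRingEnd ℂ).injective.ne (Ne.symm h2))
    -- Expanding about `b̄` isolates the single term that keeps both poles; every other term
    -- contains `b̄ - w̄` and loses the conjugate pole. These give the logarithmic part and the `C2`
    -- part of `C3` respectively.
    have hexp : (z' - starRingEnd ℂ w) ^ m = (z' - b') ^ m + (b' - starRingEnd ℂ w) *
        ∑ l ∈ Finset.range m, (m.choose (l + 1) : ℂ) * (z' - b') ^ (m - (l + 1)) * (-1) ^ l *
          (starRingEnd ℂ w - b') ^ l := by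
      have : z' - starRingEnd ℂ w = (b' - starRingEnd ℂ w) + (z' - b') := by ring
      rw [this, add_pow, Finset.sum_range_succ', Finset.mul_sum, add_comm]
      congr 1
      · simp
      · refine Finset.sum_congr rfl fun l _ => ?_
        have : (starRingEnd ℂ w - b') ^ l = (-1) ^ l * (b' - starRingEnd ℂ w) ^ l := by
          rw [← mul_pow]; congr 1; ring
        rw [this, pow_succ]
        have h4 : ((-1 : ℂ) ^ l) * (-1) ^ l = 1 := by rw [← mul_pow]; simp
        linear_combination -((b' - starRingEnd ℂ w) ^ l * (b' - starRingEnd ℂ w) *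
          (z' - b') ^ (m - (l + 1)) * (m.choose (l + 1) : ℂ)) * h4
    have hsum : ∑ l ∈ Finset.range m, (m.choose (l + 1) : ℂ) * (z' - b') ^ (m - (l + 1)) *
        (-1) ^ l * ((starRingEnd ℂ w - b') ^ l * (w - b) ^ k / (w - z)) =
        (∑ l ∈ Finset.range m, (m.choose (l + 1) : ℂ) * (z' - b') ^ (m - (l + 1)) * (-1) ^ l *
          (starRingEnd ℂ w - b') ^ l) * ((w - b) ^ k / (w - z)) := by
      rw [Finset.sum_mul]
      exact Finset.sum_congr rfl fun l _ => by ring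
    rw [hsum, cauchyKernel, conjCauchyKernel, ← hz', ← hb', hexp]
    field_simp
  have hi : ∀ l : ℕ, IntegrableOn (fun w => (m.choose (l + 1) : ℂ) * (z' - b') ^ (m - (l + 1)) *
      (-1) ^ l * ((starRingEnd ℂ w - b') ^ l * (w - b) ^ k / (w - z))) (closedBall 0 R) := fun l =>
    (integrableOn_continuous_div_sub R z (by fun_prop)).const_mul _
  rw [e, integral_const_mul,
    integral_add ((integrableOn_continuous_mul_double_pole R hne (by fun_prop)).const_mul _)
      (integrable_finsetSum _ fun l _ => hi l), integral_finsetSum _ fun l _ => hi l,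
    integral_const_mul, setIntegral_sub_pow_mul_double_pole k hz hb hzb]
  simp only [integral_const_mul, hb', setIntegral_conj_sub_pow_mul_sub_pow_div_sub _ k hz b]
  rw [C3, Nat.add_sub_cancel, Nat.add_sub_cancel, sum_Icc_one_eq_sum_range]
  refine (mul_add _ _ _).trans (Eq.trans ?_ (mul_add _ _ _).symm)
  have hsign : ∀ j : ℕ, (b' - z') ^ j = (-1) ^ j * (z' - b') ^ j := fun j => by
    rw [← mul_pow]; congr 1; ring
  congr 1
  · rw [← hb', ← hz', hsign m]
    have h4 : ((-1 : ℂ) ^ m) * (-1) ^ m = 1 := by rw [← mul_pow]; simp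
    generalize Complex.log (((R : ℂ) ^ 2 - z * b') / ((‖z - b‖ ^ 2 : ℝ) : ℂ)) = L
    field_simp
    linear_combination ((z' - b') ^ m * (C1 z b (k + 1) + (z - b) ^ k * L)) * h4
  · rw [Finset.mul_sum, Finset.mul_sum]
    refine Finset.sum_congr rfl fun l hl => ?_
    have hl' := Finset.mem_range.1 hl
    have hl0 : ((l : ℂ) + 1) ≠ 0 := Nat.cast_add_one_ne_zero l
    rw [← hb', ← hz', hsign]
    obtain ⟨d, rfl⟩ := Nat.exists_eq_add_of_lt hl'
    have h4 : ((-1 : ℂ) ^ d) * (-1) ^ d = 1 := by rw [← mul_pow]; simp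
    rw [show l + d + 1 - (l + 1) = d by omega]
    push_cast
    have hp : (-1 : ℂ) ^ (l + d + 1 + 1) * (-1) ^ d = (-1) ^ l := by
      rw [show l + d + 1 + 1 = l + d + 2 by ring, pow_add, pow_add]
      linear_combination ((-1 : ℂ) ^ l) * h4
    rw [← hp]
    field_simp
    ring

/-! ### The Hölder class on the polydisc -/

section Holder

variable {n : ℕ} {R α : ℝ} {f : (Fin n → ℂ) → ℂ}

lemma mem_polydisc {z : Fin n → ℂ} : z ∈ polydisc n R ↔ ∀ j, z j ∈ closedBall (0 : ℂ) R := by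
  simp [polydisc]

lemma update_mem_polydisc {z : Fin n → ℂ} (hz : z ∈ polydisc n R) (j : Fin n) {ζ : ℂ}
    (hζ : ζ ∈ closedBall (0 : ℂ) R) : Function.update z j ζ ∈ polydisc n R := by
  rw [mem_polydisc] at *
  intro i
  rcases eq_or_ne i j with rfl | h
  · simpa using hζ
  · simpa [h] using hz i

lemma isCompact_polydisc (n : ℕ) (R : ℝ) : IsCompact (polydisc n R) :=
  isCompact_univ_pi fun _ => isCompact_closedBall _ _

/-- All multi-index difference quotients of `f` are bounded by `C`. -/
def HolderBound (R α C : ℝ) (f : (Fin n → ℂ) → ℂ) : Prop :=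
  ∀ l : List (Fin n), l.Nodup → ∀ z ∈ polydisc n R, ∀ z' ∈ polydisc n R, (∀ i ∈ l, z i ≠ z' i) →
    ‖multiDiff f l z z'‖ ≤ C * (l.map fun i => ‖z i - z' i‖ ^ α).prod

lemma holderProd_pos {l : List (Fin n)} {z z' : Fin n → ℂ} (h : ∀ i ∈ l, z i ≠ z' i) :
    0 < (l.map fun i => ‖z i - z' i‖ ^ α).prod := by
  refine List.prod_pos fun x hx => ?_
  obtain ⟨i, hi, rfl⟩ := List.mem_map.1 hx
  have : 0 < ‖z i - z' i‖ := norm_pos_iff.2 (sub_ne_zero.2 (h i hi))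
  positivity

lemma norm_holderQuotient_le_iff {C : ℝ} {l : List (Fin n)} {z z' : Fin n → ℂ}
    (h : ∀ i ∈ l, z i ≠ z' i) :
    ‖holderQuotient α f l z z'‖ ≤ C ↔
      ‖multiDiff f l z z'‖ ≤ C * (l.map fun i => ‖z i - z' i‖ ^ α).prod := by
  have hp := holderProd_pos (α := α) h
  rw [holderQuotient, norm_div, Complex.norm_real, Real.norm_of_nonneg hp.le, div_le_iff₀ hp]

lemma memHolder_iff : MemHolder R α f ↔ ∃ C, 0 ≤ C ∧ HolderBound R α C f := by
  constructor
  · intro h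
    choose! C hC using h
    refine ⟨∑ k ∈ Finset.range (n + 1), |C k|, Finset.sum_nonneg fun _ _ => abs_nonneg _,
      fun l hl z hz z' hz' hne => ?_⟩
    have hlen : l.length ≤ n := by simpa using hl.length_le_card
    rw [← norm_holderQuotient_le_iff hne]
    refine (hC l.length hlen l hl rfl z hz z' hz' hne).trans ((le_abs_self _).trans ?_)
    exact Finset.single_le_sum (f := fun k => |C k|) (fun _ _ => abs_nonneg _)
      (Finset.mem_range.2 (by omega))
  · rintro ⟨C, -, h⟩ k -
    exact ⟨C, fun l hl _ z hz z' hz' hne =>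
      (norm_holderQuotient_le_iff hne).2 (h l hl z hz z' hz' hne)⟩

lemma HolderBound.norm_sub_update_le {C : ℝ} (h : HolderBound R α C f) {z : Fin n → ℂ}
    (hα : 0 < α) (hz : z ∈ polydisc n R) (i : Fin n) {x : ℂ} (hx : x ∈ closedBall (0 : ℂ) R) :
    ‖f z - f (Function.update z i x)‖ ≤ C * ‖z i - x‖ ^ α := by
  rcases eq_or_ne (z i) x with rfl | hne
  · simp [hα.ne']
  · simpa [multiDiff] using h [i] (by simp) z hz (Function.update z i x)
      (update_mem_polydisc hz i hx) (by simpa using hne)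

/-- Coordinates are changed one at a time along `Finset.piecewise`. Only first-order quotients are
used, and the resulting continuity is what the Fubini arguments require. -/
lemma HolderBound.norm_sub_le {C : ℝ} (h : HolderBound R α C f) (hα : 0 < α)
    {z w : Fin n → ℂ} (hz : z ∈ polydisc n R) (hw : w ∈ polydisc n R) :
    ‖f z - f w‖ ≤ ∑ i, C * ‖z i - w i‖ ^ α := by
  have key : ∀ s : Finset (Fin n), ‖f z - f (s.piecewise w z)‖ ≤ ∑ i ∈ s, C * ‖z i - w i‖ ^ α := by
    intro s
    induction s using Finset.induction_on with
    | empty => simp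
    | insert i s hi ih =>
      rw [Finset.sum_insert hi, Finset.piecewise_insert]
      have hm : s.piecewise w z ∈ polydisc n R := by
        rw [mem_polydisc] at *
        intro j
        by_cases hj : j ∈ s
        · rw [Finset.piecewise_eq_of_mem _ _ _ hj]; exact hw j
        · rw [Finset.piecewise_eq_of_notMem _ _ _ hj]; exact hz j
      have h1 := h.norm_sub_update_le hα hm i (mem_polydisc.1 hw i)
      rw [Finset.piecewise_eq_of_notMem _ _ _ hi] at h1
      calc _ ≤ ‖f z - f (s.piecewise w z)‖ +
            ‖f (s.piecewise w z) - f (Function.update (s.piecewise w z) i (w i))‖ :=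
            norm_sub_le_norm_sub_add_norm_sub _ _ _
        _ ≤ _ := by rw [add_comm]; gcongr
  simpa using key Finset.univ

lemma MemHolder.continuousOn (hα : 0 < α) (hf : MemHolder R α f) :
    ContinuousOn f (polydisc n R) := by
  obtain ⟨C, -, h⟩ := memHolder_iff.1 hf
  intro w hw
  rw [ContinuousWithinAt, tendsto_iff_norm_sub_tendsto_zero]
  have hlim : Filter.Tendsto (fun z : Fin n → ℂ => ∑ i, C * ‖z i - w i‖ ^ α)
      (nhdsWithin w (polydisc n R)) (nhds 0) := by
    have hc : Continuous fun z : Fin n → ℂ => ∑ i, C * ‖z i - w i‖ ^ α :=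
      continuous_finsetSum _ fun i _ => continuous_const.mul
        (Continuous.rpow_const (by fun_prop) fun _ => Or.inr hα.le)
    have := (hc.tendsto w).mono_left (nhdsWithin_le_nhds (s := polydisc n R))
    simpa [hα.ne'] using this
  refine squeeze_zero' (Filter.Eventually.of_forall fun _ => norm_nonneg _) ?_ hlim
  filter_upwards [self_mem_nhdsWithin] with z hz
  exact h.norm_sub_le hα hz hw

lemma continuousOn_multiDiff (hf : ContinuousOn f (polydisc n R)) (l : List (Fin n))
    {z' : Fin n → ℂ} (hz' : z' ∈ polydisc n R) :
    ContinuousOn (fun z => multiDiff f l z z') (polydisc n R) := by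
  induction l with
  | nil => simpa [multiDiff] using hf
  | cons i l ih =>
    simp only [multiDiff]
    refine ih.sub (ih.comp (by fun_prop) fun z hz => update_mem_polydisc hz i (mem_polydisc.1 hz' i))

lemma multiDiff_perm {l l' : List (Fin n)} (h : l.Perm l') (f : (Fin n → ℂ) → ℂ)
    (z z' : Fin n → ℂ) : multiDiff f l z z' = multiDiff f l' z z' := by
  induction h generalizing z with
  | nil => rfl
  | cons i _ ih => simp only [multiDiff, ih]
  | swap i j l =>
    rcases eq_or_ne i j with rfl | hne
    · rfl
    · simp only [multiDiff]
      rw [Function.update_comm hne]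
      ring
  | trans _ _ ih1 ih2 => rw [ih1, ih2]

/-- The integral operator with kernel `K` acting in the `j`-th variable. -/
def kernelOp (R : ℝ) (K : ℂ → ℂ → ℂ) (j : Fin n) (f : (Fin n → ℂ) → ℂ) : (Fin n → ℂ) → ℂ :=
  fun z => ∫ ζ in closedBall (0 : ℂ) R, K (z j) ζ * f (Function.update z j ζ)

lemma integrableOn_kernel_mul {k g : ℂ → ℂ} (hk : IntegrableOn k (closedBall 0 R))
    (hg : ContinuousOn g (closedBall 0 R)) :
    IntegrableOn (fun ζ => k ζ * g ζ) (closedBall 0 R) :=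
  hk.mul_continuousOn hg (isCompact_closedBall _ _)

lemma continuousOn_comp_update {g : (Fin n → ℂ) → ℂ} (hg : ContinuousOn g (polydisc n R))
    {z : Fin n → ℂ} (hz : z ∈ polydisc n R) (j : Fin n) :
    ContinuousOn (fun ζ => g (Function.update z j ζ)) (closedBall 0 R) :=
  hg.comp (by fun_prop) fun _ hζ => update_mem_polydisc hz j hζ

/-- The kernel sees only the coordinate `j`, so differences in the other coordinates pass to `f`. -/
lemma multiDiff_kernelOp {K : ℂ → ℂ → ℂ} {j : Fin n} (hf : ContinuousOn f (polydisc n R))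
    (hK : ∀ a ∈ closedBall (0 : ℂ) R, IntegrableOn (K a) (closedBall 0 R))
    {l : List (Fin n)} (hj : j ∉ l) {z z' : Fin n → ℂ} (hz : z ∈ polydisc n R)
    (hz' : z' ∈ polydisc n R) :
    multiDiff (kernelOp R K j f) l z z' =
      ∫ ζ in closedBall (0 : ℂ) R, K (z j) ζ * multiDiff f l (Function.update z j ζ) z' := by
  induction l generalizing z with
  | nil => rfl
  | cons i l ih =>
    simp only [List.mem_cons, not_or] at hj
    have hzi := update_mem_polydisc hz i (mem_polydisc.1 hz' i)
    have hcont := continuousOn_multiDiff hf l hz'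
    have hi := fun (y : Fin n → ℂ) (hy : y ∈ polydisc n R) =>
      integrableOn_kernel_mul (hK _ (mem_polydisc.1 hy j)) (continuousOn_comp_update hcont hy j)
    simp only [multiDiff]
    rw [ih hj.2 hz, ih hj.2 hzi, ← integral_sub (hi z hz) (hi _ hzi)]
    refine integral_congr_ae (Filter.Eventually.of_forall fun ζ => ?_)
    simp only
    rw [Function.update_of_ne hj.1, Function.update_comm hj.1]
    ring

lemma norm_setIntegral_mul_le {k g : ℂ → ℂ} {M : ℝ} (hk : IntegrableOn k (closedBall 0 R))
    (hg : ∀ ζ ∈ closedBall (0 : ℂ) R, ‖g ζ‖ ≤ M) :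
    ‖∫ ζ in closedBall (0 : ℂ) R, k ζ * g ζ‖ ≤ (∫ ζ in closedBall (0 : ℂ) R, ‖k ζ‖) * M := by
  rw [← integral_mul_const]
  refine norm_integral_le_of_norm_le (hk.norm.mul_const M)
    ((ae_restrict_iff' measurableSet_closedBall).2 (Filter.Eventually.of_forall fun ζ hζ => ?_))
  rw [norm_mul]
  gcongr
  exact hg ζ hζ

lemma MemHolder.kernelOp {K : ℂ → ℂ → ℂ} {j : Fin n} {C₁ C₂ : ℝ} (hα : 0 < α)
    (hf : MemHolder R α f)
    (hK : ∀ a ∈ closedBall (0 : ℂ) R, IntegrableOn (K a) (closedBall 0 R)) (hC₁ : 0 ≤ C₁)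
    (hK₁ : ∀ a ∈ closedBall (0 : ℂ) R, ∫ ζ in closedBall (0 : ℂ) R, ‖K a ζ‖ ≤ C₁) (hC₂ : 0 ≤ C₂)
    (hK₂ : ∀ a ∈ closedBall (0 : ℂ) R, ∀ b ∈ closedBall (0 : ℂ) R,
      ∫ ζ in closedBall (0 : ℂ) R, ‖K a ζ - K b ζ‖ ≤ C₂ * ‖a - b‖ ^ α) :
    MemHolder R α (PolydiscGreen.kernelOp R K j f) := by
  have hc := hf.continuousOn hα
  obtain ⟨C, hC, h⟩ := memHolder_iff.1 hf
  refine memHolder_iff.2 ⟨C₁ * C + C₂ * C, by positivity, fun l hl z hz z' hz' hne => ?_⟩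
  have hbd : ∀ l' : List (Fin n), l'.Nodup → j ∉ l' → (∀ i ∈ l', z i ≠ z' i) →
      ∀ ζ ∈ closedBall (0 : ℂ) R, ‖multiDiff f l' (Function.update z j ζ) z'‖ ≤
        C * (l'.map fun i => ‖z i - z' i‖ ^ α).prod := by
    intro l' hl' hj hne' ζ hζ
    have hne_j : ∀ i ∈ l', i ≠ j := fun i hi h => hj (h ▸ hi)
    have := h l' hl' _ (update_mem_polydisc hz j hζ) z' hz' fun i hi => by
      rw [Function.update_of_ne (hne_j i hi)]; exact hne' i hi
    rwa [List.map_congr_left fun i hi => by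
      rw [Function.update_of_ne (hne_j i hi)]] at this
  by_cases hj : j ∈ l
  -- Order of differences is irrelevant, so `j` may be taken last. Since `T_j` integrates out the
  -- coordinate `j`, both terms carry the same difference of `f`, and only the kernels are
  -- subtracted.
  · have hperm := List.perm_cons_erase hj
    have hnd : (j :: l.erase j).Nodup := hperm.nodup_iff.1 hl
    have hj' : j ∉ l.erase j := (List.nodup_cons.1 hnd).1
    have hne' : ∀ i ∈ l.erase j, z i ≠ z' i := fun i hi => hne i (List.mem_of_mem_erase hi)
    have hzj := update_mem_polydisc hz j (mem_polydisc.1 hz' j)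
    have hcont := continuousOn_comp_update (continuousOn_multiDiff hc (l.erase j) hz') hz j
    have ha := mem_polydisc.1 hz j
    have hb := mem_polydisc.1 hz' j
    have hQ := holderProd_pos (α := α) hne'
    rw [multiDiff_perm hperm, (hperm.map _).prod_eq, List.map_cons, List.prod_cons, multiDiff,
      multiDiff_kernelOp hc hK hj' hz hz', multiDiff_kernelOp hc hK hj' hzj hz']
    simp only [Function.update_self, Function.update_idem]
    rw [← integral_sub (integrableOn_kernel_mul (hK _ ha) hcont)
      (integrableOn_kernel_mul (hK _ hb) hcont)]
    simp only [← sub_mul]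
    refine (norm_setIntegral_mul_le ((hK _ ha).sub (hK _ hb))
      (hbd _ (List.nodup_cons.1 hnd).2 hj' hne')).trans ?_
    simp only [Pi.sub_apply]
    calc _ ≤ C₂ * ‖z j - z' j‖ ^ α *
          (C * ((l.erase j).map fun i => ‖z i - z' i‖ ^ α).prod) := by
          gcongr
          exact hK₂ _ ha _ hb
      _ = C₂ * C * (‖z j - z' j‖ ^ α *
          ((l.erase j).map fun i => ‖z i - z' i‖ ^ α).prod) := by ring
      _ ≤ _ := by
          gcongr
          linarith [mul_nonneg hC₁ hC]
  · have hQ := holderProd_pos (α := α) hne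
    rw [multiDiff_kernelOp hc hK hj hz hz']
    refine (norm_setIntegral_mul_le (hK _ (mem_polydisc.1 hz j)) (hbd l hl hj hne)).trans ?_
    calc _ ≤ C₁ * (C * (l.map fun i => ‖z i - z' i‖ ^ α).prod) := by
          gcongr
          exact hK₁ _ (mem_polydisc.1 hz j)
      _ = C₁ * C * (l.map fun i => ‖z i - z' i‖ ^ α).prod := by ring
      _ ≤ _ := by
          gcongr
          linarith [mul_nonneg hC₂ hC]

/-! ### The operators `T_j` and `T̄_j` preserve the Hölder class -/

lemma const_mul_two_I_mul (x : ℂ) :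
    (-1 / (2 * (Real.pi : ℂ) * Complex.I)) * (2 * Complex.I * x) = -(1 / (Real.pi : ℂ)) * x := by
  have hπ : (Real.pi : ℂ) ≠ 0 := by exact_mod_cast Real.pi_ne_zero
  field_simp

lemma opT_eq_kernelOp (R : ℝ) (j : Fin n) (f : (Fin n → ℂ) → ℂ) :
    opT R j f = kernelOp R (cauchyKernel 0) j f := by
  funext z
  rw [opT, discIntegral, const_mul_two_I_mul, kernelOp, ← integral_const_mul]
  simp only [cauchyKernel, pow_zero, Nat.factorial_zero, Nat.cast_one]
  exact integral_congr_ae (Filter.Eventually.of_forall fun ζ => by simp only; ring)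

lemma opTbar_eq_kernelOp (R : ℝ) (j : Fin n) (f : (Fin n → ℂ) → ℂ) :
    opTbar R j f = kernelOp R (conjCauchyKernel 0) j f := by
  funext z
  rw [opTbar, discIntegral, const_mul_two_I_mul, kernelOp, ← integral_const_mul]
  simp only [conjCauchyKernel, pow_zero, Nat.factorial_zero, Nat.cast_one]
  exact integral_congr_ae (Filter.Eventually.of_forall fun ζ => by simp only; ring)

/-- A measurable kernel with a singularity of order one on the diagonal of the disc. -/
structure WeaklySingular (R : ℝ) (K : ℂ → ℂ → ℂ) : Prop where
  measurable : Measurable (Function.uncurry K)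
  bound : ∃ C : ℝ, 0 ≤ C ∧ ∀ z ∈ closedBall (0 : ℂ) R, ∀ ζ ∈ closedBall (0 : ℂ) R,
    ‖K z ζ‖ ≤ C * ‖ζ - z‖⁻¹

lemma WeaklySingular.integrableOn {K : ℂ → ℂ → ℂ} (hK : WeaklySingular R K) {z : ℂ}
    (hz : z ∈ closedBall (0 : ℂ) R) : IntegrableOn (K z) (closedBall 0 R) := by
  obtain ⟨C, -, h⟩ := hK.bound
  exact integrableOn_of_norm_le_inv
    (hK.measurable.comp measurable_prodMk_left).aestronglyMeasurable (h z hz)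

lemma WeaklySingular.exists_integral_norm_le {K : ℂ → ℂ → ℂ} (hK : WeaklySingular R K) :
    ∃ C : ℝ, 0 ≤ C ∧ ∀ z ∈ closedBall (0 : ℂ) R,
      ∫ ζ in closedBall (0 : ℂ) R, ‖K z ζ‖ ≤ C := by
  obtain ⟨C, hC, h⟩ := hK.bound
  obtain ⟨C', hC', h'⟩ := exists_setIntegral_norm_sub_inv_le R
  refine ⟨C * C', by positivity, fun z hz => ?_⟩
  calc ∫ ζ in closedBall (0 : ℂ) R, ‖K z ζ‖
      ≤ ∫ ζ in closedBall (0 : ℂ) R, C * ‖ζ - z‖⁻¹ :=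
        setIntegral_mono_on (hK.integrableOn hz).norm
          ((integrableOn_norm_sub_inv R z).const_mul C) measurableSet_closedBall (h z hz)
    _ = C * ∫ ζ in closedBall (0 : ℂ) R, ‖ζ - z‖⁻¹ := integral_const_mul _ _
    _ ≤ C * C' := by gcongr; exact h' z hz

lemma norm_conjCauchyKernel (k : ℕ) (z ζ : ℂ) :
    ‖conjCauchyKernel k z ζ‖ = ‖cauchyKernel k z ζ‖ := by
  rw [← conj_cauchyKernel, Complex.norm_conj]

lemma weaklySingular_cauchyKernel (R : ℝ) (m : ℕ) : WeaklySingular R (cauchyKernel m) where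
  measurable := by
    unfold cauchyKernel Function.uncurry
    fun_prop
  bound := by
    refine ⟨1 / Real.pi * (|2 * R| ^ m / m.factorial), by positivity, fun z hz ζ hζ => ?_⟩
    have h1 : ‖starRingEnd ℂ z - starRingEnd ℂ ζ‖ ≤ |2 * R| := by
      rw [← map_sub, Complex.norm_conj]
      simp only [mem_closedBall, dist_zero_right] at hz hζ
      exact (norm_sub_le _ _).trans ((by linarith : _ ≤ 2 * R).trans (le_abs_self _))
    rw [cauchyKernel, norm_mul, norm_neg, norm_div, norm_div, norm_div, norm_pow, norm_one,
      Complex.norm_real, Real.norm_of_nonneg Real.pi_pos.le, Complex.norm_natCast, mul_assoc,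
      ← div_eq_mul_inv]
    gcongr

lemma weaklySingular_conjCauchyKernel (R : ℝ) (m : ℕ) :
    WeaklySingular R (conjCauchyKernel m) where
  measurable := by
    unfold conjCauchyKernel Function.uncurry
    fun_prop
  bound := by
    simpa only [norm_conjCauchyKernel] using (weaklySingular_cauchyKernel R m).bound

lemma MemHolder.opT (hα₀ : 0 < α) (hα₁ : α < 1) (hf : MemHolder R α f) (j : Fin n) :
    MemHolder R α (opT R j f) := by
  rw [opT_eq_kernelOp]
  have hK := weaklySingular_cauchyKernel R 0
  obtain ⟨C₁, hC₁, h₁⟩ := hK.exists_integral_norm_le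
  obtain ⟨C₂, hC₂, h₂⟩ := exists_setIntegral_norm_inv_sub_inv_le hα₀ hα₁ R
  refine hf.kernelOp (C₂ := 1 / Real.pi * C₂) hα₀ (fun a ha => hK.integrableOn ha) hC₁ h₁
    (by positivity) fun a ha b hb => ?_
  have e : ∀ ζ, ‖cauchyKernel 0 a ζ - cauchyKernel 0 b ζ‖ =
      1 / Real.pi * ‖(ζ - a)⁻¹ - (ζ - b)⁻¹‖ := fun ζ => by
    simp only [cauchyKernel, pow_zero, Nat.factorial_zero, Nat.cast_one, div_one]
    rw [← mul_sub, norm_mul, norm_neg, norm_div, norm_one, Complex.norm_real,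
      Real.norm_of_nonneg Real.pi_pos.le, one_div, one_div, one_div]
  simp only [e]
  rw [integral_const_mul, mul_assoc]
  gcongr
  exact h₂ a ha b hb

lemma MemHolder.opTbar (hα₀ : 0 < α) (hα₁ : α < 1) (hf : MemHolder R α f) (j : Fin n) :
    MemHolder R α (opTbar R j f) := by
  rw [opTbar_eq_kernelOp]
  have hK := weaklySingular_conjCauchyKernel R 0
  obtain ⟨C₁, hC₁, h₁⟩ := hK.exists_integral_norm_le
  obtain ⟨C₂, hC₂, h₂⟩ := exists_setIntegral_norm_inv_sub_inv_le hα₀ hα₁ R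
  refine hf.kernelOp (C₂ := 1 / Real.pi * C₂) hα₀ (fun a ha => hK.integrableOn ha) hC₁ h₁
    (by positivity) fun a ha b hb => ?_
  have e : ∀ ζ, ‖conjCauchyKernel 0 a ζ - conjCauchyKernel 0 b ζ‖ =
      1 / Real.pi * ‖(ζ - a)⁻¹ - (ζ - b)⁻¹‖ := fun ζ => by
    rw [← conj_cauchyKernel, ← conj_cauchyKernel, ← map_sub, Complex.norm_conj]
    simp only [cauchyKernel, pow_zero, Nat.factorial_zero, Nat.cast_one, div_one]
    rw [← mul_sub, norm_mul, norm_neg, norm_div, norm_one, Complex.norm_real,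
      Real.norm_of_nonneg Real.pi_pos.le, one_div, one_div, one_div]
  simp only [e]
  rw [integral_const_mul, mul_assoc]
  gcongr
  exact h₂ a ha b hb

end Holder

/-! ### Fubini for kernels -/

section Fubini

variable {X Y : Type*} [MeasurableSpace X] [MeasurableSpace Y] {μ : Measure X} {ν : Measure Y}
  [SFinite ν] {a : X → ℂ} {H : X → Y → ℂ} {C : ℝ}

/-- Tonelli with `H x` bounded in `L¹` uniformly in `x`. It serves both the one-variable iterates
and the composition on the polydisc. -/
lemma integrable_prod_mul_kernel (ha : Integrable a μ)
    (hH : AEStronglyMeasurable (Function.uncurry H) (μ.prod ν))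
    (hi : ∀ᵐ x ∂μ, Integrable (H x) ν) (hC : ∀ᵐ x ∂μ, ∫ y, ‖H x y‖ ∂ν ≤ C) :
    Integrable (fun p : X × Y => a p.1 * H p.1 p.2) (μ.prod ν) := by
  have hm : AEStronglyMeasurable (fun p : X × Y => a p.1 * H p.1 p.2) (μ.prod ν) :=
    ha.aestronglyMeasurable.comp_fst.mul hH
  refine (integrable_prod_iff hm).2 ⟨?_, ?_⟩
  · filter_upwards [hi] with x hx using hx.const_mul _
  · refine Integrable.mono' (ha.norm.mul_const C) hm.norm.integral_prod_right' ?_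
    filter_upwards [hC] with x hx
    simp only [norm_mul, integral_const_mul]
    rw [norm_norm, Real.norm_of_nonneg (integral_nonneg fun _ => norm_nonneg _)]
    gcongr

lemma integral_mul_integral_kernel_swap [SFinite μ] (ha : Integrable a μ)
    (hH : AEStronglyMeasurable (Function.uncurry H) (μ.prod ν))
    (hi : ∀ᵐ x ∂μ, Integrable (H x) ν) (hC : ∀ᵐ x ∂μ, ∫ y, ‖H x y‖ ∂ν ≤ C) :
    ∫ x, a x * ∫ y, H x y ∂ν ∂μ = ∫ y, ∫ x, a x * H x y ∂μ ∂ν := by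
  simp only [← integral_const_mul]
  exact integral_integral_swap (integrable_prod_mul_kernel ha hH hi hC)

end Fubini

section Polydisc

variable {n : ℕ} {R α : ℝ} {f : (Fin n → ℂ) → ℂ}

/-! ### Iterates of a kernel operator in one variable -/

lemma kernelOp_congr {K : ℂ → ℂ → ℂ} {j : Fin n} {g : (Fin n → ℂ) → ℂ}
    (h : EqOn f g (polydisc n R)) :
    EqOn (kernelOp R K j f) (kernelOp R K j g) (polydisc n R) := fun z hz =>
  setIntegral_congr_fun measurableSet_closedBall fun ζ hζ => by
    simp only [h (update_mem_polydisc hz j hζ)]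

lemma kernelOp_iterate_succ {K : ℕ → ℂ → ℂ → ℂ} (hK : ∀ m, WeaklySingular R (K m))
    (hcomp : ∀ m, ∀ z ∈ closedBall (0 : ℂ) R, ∀ ζ ∈ closedBall (0 : ℂ) R, ζ ≠ z →
      ∫ w in closedBall (0 : ℂ) R, K 0 z w * K m w ζ = K (m + 1) z ζ)
    (hf : ContinuousOn f (polydisc n R)) (j : Fin n) (m : ℕ) :
    EqOn ((kernelOp R (K 0) j)^[m + 1] f) (kernelOp R (K m) j f) (polydisc n R) := by
  induction m with
  | zero => exact fun _ _ => rfl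
  | succ m ih =>
    intro z hz
    rw [Function.iterate_succ_apply', kernelOp_congr ih hz]
    have hg := continuousOn_comp_update hf hz j
    have hzj := mem_polydisc.1 hz j
    obtain ⟨M, hM⟩ := (isCompact_closedBall (0 : ℂ) R).exists_bound_of_continuousOn hg
    obtain ⟨C, hC, hCK⟩ := (hK m).exists_integral_norm_le
    have hM0 : 0 ≤ M := (norm_nonneg _).trans (hM _ hzj)
    simp only [kernelOp, Function.update_self, Function.update_idem]
    rw [integral_mul_integral_kernel_swap (C := C * M) ((hK 0).integrableOn hzj)]
    · refine integral_congr_ae ?_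
      filter_upwards [ae_restrict_mem measurableSet_closedBall, ae_restrict_of_ae (ae_ne (z j))]
        with ζ hζ hne
      simp only [← mul_assoc]
      rw [integral_mul_const, hcomp m _ hzj ζ hζ hne]
    · exact (hK m).measurable.aestronglyMeasurable.mul
        (hg.aestronglyMeasurable measurableSet_closedBall).comp_snd
    · filter_upwards [ae_restrict_mem measurableSet_closedBall] with w hw
      exact integrableOn_kernel_mul ((hK m).integrableOn hw) hg
    · filter_upwards [ae_restrict_mem measurableSet_closedBall] with w hw
      calc ∫ ζ in closedBall (0 : ℂ) R, ‖K m w ζ * f (Function.update z j ζ)‖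
          ≤ ∫ ζ in closedBall (0 : ℂ) R, ‖K m w ζ‖ * M := by
            refine setIntegral_mono_on (integrableOn_kernel_mul ((hK m).integrableOn hw) hg).norm
              (((hK m).integrableOn hw).norm.mul_const M) measurableSet_closedBall fun ζ hζ => ?_
            rw [norm_mul]
            gcongr
            exact hM ζ hζ
        _ = (∫ ζ in closedBall (0 : ℂ) R, ‖K m w ζ‖) * M := integral_mul_const _ _
        _ ≤ C * M := by gcongr; exact hCK w hw

/-! ### Products of kernel operators -/

lemma restrict_polydisc (n : ℕ) (R : ℝ) :
    (volume : Measure (Fin n → ℂ)).restrict (polydisc n R) =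
      Measure.pi fun _ => (volume : Measure ℂ).restrict (closedBall 0 R) := by
  rw [polydisc, volume_pi, Measure.restrict_pi_pi]

lemma integrableOn_prod_kernel {k : Fin n → ℂ → ℂ}
    (hk : ∀ j, IntegrableOn (k j) (closedBall 0 R)) :
    IntegrableOn (fun η : Fin n → ℂ => ∏ j, k j (η j)) (polydisc n R) := by
  rw [IntegrableOn, restrict_polydisc]
  exact Integrable.fintype_prod hk

lemma integrableOn_prod_kernel_mul {k : Fin n → ℂ → ℂ}
    (hk : ∀ j, IntegrableOn (k j) (closedBall 0 R)) (hf : ContinuousOn f (polydisc n R)) :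
    IntegrableOn (fun η => (∏ j, k j (η j)) * f η) (polydisc n R) :=
  (integrableOn_prod_kernel hk).mul_continuousOn hf (isCompact_polydisc n R)

/-- Operators in the later coordinates leave coordinate `0` frozen; this drives the induction on
dimension in `foldr_kernelOp_finRange`. -/
lemma foldr_kernelOp_cons (K : Fin (n + 1) → ℂ → ℂ → ℂ) (f : (Fin (n + 1) → ℂ) → ℂ) (a : ℂ)
    (l : List (Fin n)) (y : Fin n → ℂ) :
    l.foldr (fun j g => kernelOp R (K j.succ) j.succ g) f (Fin.cons a y) =
      l.foldr (fun j g => kernelOp R (K j.succ) j g) (fun y => f (Fin.cons a y)) y := by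
  induction l generalizing y with
  | nil => rfl
  | cons j l ih =>
    simp only [List.foldr_cons, kernelOp, Fin.cons_succ]
    refine integral_congr_ae (Filter.Eventually.of_forall fun ζ => ?_)
    simp only
    rw [← Fin.cons_update, ih]

lemma cons_mem_polydisc {a : ℂ} (ha : a ∈ closedBall (0 : ℂ) R) {y : Fin n → ℂ}
    (hy : y ∈ polydisc n R) : (Fin.cons a y : Fin (n + 1) → ℂ) ∈ polydisc (n + 1) R := by
  rw [mem_polydisc] at *
  intro j
  refine Fin.cases ?_ (fun i => ?_) j
  · simpa using ha
  · simpa using hy i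

lemma foldr_kernelOp_finRange {K : Fin n → ℂ → ℂ → ℂ} (hK : ∀ j, WeaklySingular R (K j))
    (hf : ContinuousOn f (polydisc n R)) {z : Fin n → ℂ} (hz : z ∈ polydisc n R) :
    (List.finRange n).foldr (fun j g => kernelOp R (K j) j g) f z =
      ∫ η in polydisc n R, (∏ j, K j (z j) (η j)) * f η := by
  induction n with
  | zero =>
    rw [restrict_polydisc, Measure.pi_of_empty _ 0, integral_dirac]
    simp [Subsingleton.elim z 0]
  | succ n ih =>
    have hzj := mem_polydisc.1 hz
    have hint := integrableOn_prod_kernel_mul (fun j => (hK j).integrableOn (hzj j)) hf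
    have hmp := (measurePreserving_piFinSuccAbove
      (fun _ : Fin (n + 1) => (volume : Measure ℂ).restrict (closedBall 0 R)) 0).symm
    rw [IntegrableOn, restrict_polydisc,
      ← hmp.integrable_comp_emb (MeasurableEquiv.measurableEmbedding _)] at hint
    rw [restrict_polydisc, ← hmp.integral_comp (MeasurableEquiv.measurableEmbedding _)]
    simp only [Function.comp_def, MeasurableEquiv.piFinSuccAbove_symm_apply, Fin.insertNthEquiv,
      Equiv.coe_fn_mk, Fin.insertNth_zero', Fin.prod_univ_succ, Fin.cons_zero, Fin.cons_succ]
      at hint ⊢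
    rw [integral_prod _ hint, List.finRange_succ, List.foldr_cons, List.foldr_map, kernelOp]
    refine setIntegral_congr_fun measurableSet_closedBall fun ζ hζ => ?_
    have hupd : Function.update z 0 ζ = Fin.cons ζ (Fin.tail z) := by
      conv_lhs => rw [← Fin.cons_self_tail z]
      rw [Fin.update_cons_zero]
    have htail : Fin.tail z ∈ polydisc n R := mem_polydisc.2 fun j => hzj j.succ
    have hfc : ContinuousOn (fun y : Fin n → ℂ => f (Fin.cons ζ y)) (polydisc n R) :=
      hf.comp (by fun_prop) fun y hy => cons_mem_polydisc hζ hy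
    simp only
    rw [hupd, foldr_kernelOp_cons, ih (fun j => hK j.succ) hfc htail, ← integral_const_mul,
      restrict_polydisc]
    refine integral_congr_ae (Filter.Eventually.of_forall fun η => ?_)
    simp only [Fin.tail, mul_assoc]

/-- Both conclusions are proved together because replacing `P j` by its kernel is justified only on
Hölder functions. -/
lemma foldr_memHolder_eqOn {P : Fin n → ((Fin n → ℂ) → ℂ) → (Fin n → ℂ) → ℂ}
    {K : Fin n → ℂ → ℂ → ℂ} (hP : ∀ j g, MemHolder R α g → MemHolder R α (P j g))
    (hPK : ∀ j g, MemHolder R α g → EqOn (P j g) (kernelOp R (K j) j g) (polydisc n R))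
    (hf : MemHolder R α f) (l : List (Fin n)) :
    MemHolder R α (l.foldr (fun j g => P j g) f) ∧
      EqOn (l.foldr (fun j g => P j g) f) (l.foldr (fun j g => kernelOp R (K j) j g) f)
        (polydisc n R) := by
  induction l with
  | nil => exact ⟨hf, fun _ _ => rfl⟩
  | cons j l ih =>
    exact ⟨hP j _ ih.1, (hPK j _ ih.1).trans (kernelOp_congr ih.2)⟩

lemma MemHolder.iterate {P : ((Fin n → ℂ) → ℂ) → (Fin n → ℂ) → ℂ}
    (hP : ∀ g, MemHolder R α g → MemHolder R α (P g)) (hf : MemHolder R α f) (m : ℕ) :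
    MemHolder R α (P^[m] f) := by
  induction m with
  | zero => exact hf
  | succ m ih => rw [Function.iterate_succ_apply']; exact hP _ ih

/-! ### Composition of two product kernels -/

lemma aestronglyMeasurable_prod_kernel_mul {B : Fin n → ℂ → ℂ → ℂ}
    (hB : ∀ j, WeaklySingular R (B j)) (hf : ContinuousOn f (polydisc n R)) :
    AEStronglyMeasurable
      (Function.uncurry fun w η : Fin n → ℂ => (∏ j, B j (w j) (η j)) * f η)
      ((volume.restrict (polydisc n R)).prod (volume.restrict (polydisc n R))) := by
  refine AEStronglyMeasurable.mul (f := fun p : (Fin n → ℂ) × (Fin n → ℂ) =>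
    ∏ j, B j (p.1 j) (p.2 j)) (Measurable.aestronglyMeasurable ?_)
    (hf.aestronglyMeasurable (isCompact_polydisc n R).measurableSet).comp_snd
  refine Finset.measurable_prod _ fun j _ => ?_
  exact (hB j).measurable.comp (f := fun p : (Fin n → ℂ) × (Fin n → ℂ) => (p.1 j, p.2 j))
    (by fun_prop)

lemma exists_integral_norm_prod_kernel_mul_le {B : Fin n → ℂ → ℂ → ℂ}
    (hB : ∀ j, WeaklySingular R (B j)) (hf : ContinuousOn f (polydisc n R)) :
    ∃ C : ℝ, ∀ w ∈ polydisc n R,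
      ∫ η in polydisc n R, ‖(∏ j, B j (w j) (η j)) * f η‖ ≤ C := by
  obtain ⟨M, hM⟩ := (isCompact_polydisc n R).exists_bound_of_continuousOn hf
  choose C hC hCB using fun j => (hB j).exists_integral_norm_le
  refine ⟨(∏ j, C j) * M, fun w hw => ?_⟩
  have hM0 : 0 ≤ M := (norm_nonneg _).trans (hM w hw)
  have hwj := mem_polydisc.1 hw
  have hi := fun j => (hB j).integrableOn (hwj j)
  calc ∫ η in polydisc n R, ‖(∏ j, B j (w j) (η j)) * f η‖
      ≤ ∫ η in polydisc n R, (∏ j, ‖B j (w j) (η j)‖) * M := by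
        refine setIntegral_mono_on (integrableOn_prod_kernel_mul hi hf).norm ?_
          (isCompact_polydisc n R).measurableSet fun η hη => ?_
        · simpa only [IntegrableOn, norm_prod] using (integrableOn_prod_kernel hi).norm.mul_const M
        · rw [norm_mul, norm_prod]
          have := hM η hη
          have h0 : 0 ≤ ∏ j, ‖B j (w j) (η j)‖ := Finset.prod_nonneg fun _ _ => norm_nonneg _
          gcongr
    _ = (∏ j, ∫ ζ in closedBall (0 : ℂ) R, ‖B j (w j) ζ‖) * M := by
        rw [integral_mul_const, restrict_polydisc,
          integral_fintype_prod_eq_prod (fun j ζ => ‖B j (w j) ζ‖)]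
    _ ≤ (∏ j, C j) * M := by
        refine mul_le_mul_of_nonneg_right (Finset.prod_le_prod
          (fun j _ => integral_nonneg fun _ => norm_nonneg _) fun j _ => hCB j _ (hwj j)) hM0

lemma integrable_and_integral_prod_kernel_comp {A B : Fin n → ℂ → ℂ → ℂ}
    (hA : ∀ j, WeaklySingular R (A j)) (hB : ∀ j, WeaklySingular R (B j))
    (hf : ContinuousOn f (polydisc n R)) {z : Fin n → ℂ} (hz : z ∈ polydisc n R)
    {G : Fin n → ℂ → ℂ}
    (hG : ∀ j, ∀ᵐ ζ ∂volume.restrict (closedBall (0 : ℂ) R),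
      ∫ w in closedBall (0 : ℂ) R, A j (z j) w * B j w ζ = G j ζ) :
    IntegrableOn (fun η => (∏ j, G j (η j)) * f η) (polydisc n R) ∧
      ∫ w in polydisc n R, (∏ j, A j (z j) (w j)) *
          ∫ η in polydisc n R, (∏ j, B j (w j) (η j)) * f η =
        ∫ η in polydisc n R, (∏ j, G j (η j)) * f η := by
  have hmeas := (isCompact_polydisc n R).measurableSet
  have ha := integrableOn_prod_kernel fun j => (hA j).integrableOn (mem_polydisc.1 hz j)
  obtain ⟨C, hC⟩ := exists_integral_norm_prod_kernel_mul_le hB hf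
  have hH := aestronglyMeasurable_prod_kernel_mul hB hf
  have hi : ∀ᵐ w ∂volume.restrict (polydisc n R),
      IntegrableOn (fun η => (∏ j, B j (w j) (η j)) * f η) (polydisc n R) := by
    filter_upwards [ae_restrict_mem hmeas] with w hw
    exact integrableOn_prod_kernel_mul (fun j => (hB j).integrableOn (mem_polydisc.1 hw j)) hf
  have hb : ∀ᵐ w ∂volume.restrict (polydisc n R),
      ∫ η in polydisc n R, ‖(∏ j, B j (w j) (η j)) * f η‖ ≤ C := by
    filter_upwards [ae_restrict_mem hmeas] with w hw using hC w hw
  have hae : ∀ᵐ η ∂volume.restrict (polydisc n R),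
      ∫ w in polydisc n R, (∏ j, A j (z j) (w j)) * ((∏ j, B j (w j) (η j)) * f η) =
        (∏ j, G j (η j)) * f η := by
    have h1 : ∀ᵐ η ∂volume.restrict (polydisc n R), ∀ j,
        ∫ w in closedBall (0 : ℂ) R, A j (z j) w * B j w (η j) = G j (η j) := by
      rw [restrict_polydisc, ae_all_iff]
      exact fun j => (Measure.tendsto_eval_ae_ae
        (μ := fun _ : Fin n => volume.restrict (closedBall (0 : ℂ) R)) (i := j)).eventually (hG j)
    filter_upwards [h1] with η hη
    simp only [← mul_assoc, ← Finset.prod_mul_distrib]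
    rw [integral_mul_const, restrict_polydisc,
      integral_fintype_prod_eq_prod (fun j w => A j (z j) w * B j w (η j))]
    simp only [hη]
  -- The partial integral in `w` of an integrable function is integrable in `η`, and it equals the
  -- composed kernel times `f` almost everywhere.
  refine ⟨(integrable_prod_mul_kernel ha hH hi hb).integral_prod_right.congr hae, ?_⟩
  rw [integral_mul_integral_kernel_swap ha hH hi hb]
  exact integral_congr_ae hae

end Polydisc

end PolydiscGreen

end

/-! ### The representation formula -/

theorem corollary3p1 (n : ℕ) (R α : ℝ) (hR : 0 < R) (hα₀ : 0 < α) (hα₁ : α < 1)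
    (μ ν : Fin n → ℕ) (hμ : ∀ j, 0 < μ j) (hν : ∀ j, 0 < ν j)
    (f : (Fin n → ℂ) → ℂ) (hf : PolydiscGreen.MemHolder R α f) :
    PolydiscGreen.MemHolder R α (PolydiscGreen.greenOp R μ ν f) ∧
    ∀ z ∈ PolydiscGreen.polydisc n R,
      IntegrableOn (fun η => (∏ j, PolydiscGreen.C3 R (z j) (η j) (μ j) (ν j)) * f η)
        (PolydiscGreen.polydisc n R) ∧
      -- the volume form `dη̄₁ ∧ dη₁ ⋯ dη̄ₙ ∧ dηₙ` is `(2i)^n` times Lebesgue measure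
      PolydiscGreen.greenOp R μ ν f z =
        PolydiscGreen.C8 μ ν * ((2 * Complex.I) ^ n *
          ∫ η in PolydiscGreen.polydisc n R,
            (∏ j, PolydiscGreen.C3 R (z j) (η j) (μ j) (ν j)) * f η) := by
  have hAop : ∀ (j : Fin n) (g : (Fin n → ℂ) → ℂ), PolydiscGreen.MemHolder R α g →
      Set.EqOn ((PolydiscGreen.opT R j)^[μ j] g)
        (PolydiscGreen.kernelOp R (PolydiscGreen.cauchyKernel (μ j - 1)) j g)
        (PolydiscGreen.polydisc n R) := by
    intro j g hg
    rw [funext (PolydiscGreen.opT_eq_kernelOp R j)]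
    have := PolydiscGreen.kernelOp_iterate_succ (PolydiscGreen.weaklySingular_cauchyKernel R)
      (fun m z hz ζ hζ hne => PolydiscGreen.setIntegral_cauchyKernel_zero_mul m hz hζ hne)
      (hg.continuousOn hα₀) j (μ j - 1)
    rwa [Nat.sub_add_cancel (hμ j)] at this
  have hBop : ∀ (j : Fin n) (g : (Fin n → ℂ) → ℂ), PolydiscGreen.MemHolder R α g →
      Set.EqOn ((PolydiscGreen.opTbar R j)^[ν j] g)
        (PolydiscGreen.kernelOp R (PolydiscGreen.conjCauchyKernel (ν j - 1)) j g)
        (PolydiscGreen.polydisc n R) := by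
    intro j g hg
    rw [funext (PolydiscGreen.opTbar_eq_kernelOp R j)]
    have := PolydiscGreen.kernelOp_iterate_succ (PolydiscGreen.weaklySingular_conjCauchyKernel R)
      (fun m z hz ζ hζ hne => PolydiscGreen.setIntegral_conjCauchyKernel_zero_mul m hz hζ hne)
      (hg.continuousOn hα₀) j (ν j - 1)
    rwa [Nat.sub_add_cancel (hν j)] at this
  obtain ⟨hF, hFeq⟩ := PolydiscGreen.foldr_memHolder_eqOn
    (fun j g hg => PolydiscGreen.MemHolder.iterate (fun _ h => h.opTbar hα₀ hα₁ j) hg (ν j)) hBop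
    hf (List.finRange n)
  obtain ⟨hG, hGeq⟩ := PolydiscGreen.foldr_memHolder_eqOn
    (fun j g hg => PolydiscGreen.MemHolder.iterate (fun _ h => h.opT hα₀ hα₁ j) hg (μ j)) hAop
    hF (List.finRange n)
  refine ⟨hG, fun z hz => ?_⟩
  have hfc := hf.continuousOn hα₀
  -- The one-variable constants for `m = μ j - 1` and `k = ν j - 1`. Their product is `C8` times
  -- `(2i) ^ n`, the factor `2i` per variable coming from `dζ̄ ∧ dζ`.
  set c : Fin n → ℂ := fun j => (-1) ^ (μ j) /
    (Real.pi * (μ j - 1).factorial * (ν j - 1).factorial) with hc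
  have hπ : (Real.pi : ℂ) ≠ 0 := by exact_mod_cast Real.pi_ne_zero
  have hfac : ∀ m : ℕ, (m.factorial : ℂ) ≠ 0 := fun m => by exact_mod_cast m.factorial_ne_zero
  have hc0 : ∏ j, c j ≠ 0 := Finset.prod_ne_zero_iff.2 fun j _ =>
    div_ne_zero (pow_ne_zero _ (by norm_num))
      (mul_ne_zero (mul_ne_zero hπ (hfac _)) (hfac _))
  have hcC8 : ∏ j, c j = PolydiscGreen.C8 μ ν * (2 * Complex.I) ^ n := by
    have hI := Complex.I_ne_zero
    have h1 : ∏ j : Fin n, (Real.pi : ℂ) = (Real.pi : ℂ) ^ n := by simp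
    rw [hc, PolydiscGreen.C8, Finset.prod_div_distrib, Finset.prod_pow_eq_pow_sum,
      Finset.prod_mul_distrib, Finset.prod_mul_distrib, h1]
    have hp1 : ∏ j, ((μ j - 1).factorial : ℂ) ≠ 0 := Finset.prod_ne_zero_iff.2 fun j _ => hfac _
    have hp2 : ∏ j, ((ν j - 1).factorial : ℂ) ≠ 0 := Finset.prod_ne_zero_iff.2 fun j _ => hfac _
    have h2 : (2 * (Real.pi : ℂ) * Complex.I) ^ n = (Real.pi : ℂ) ^ n * (2 * Complex.I) ^ n := by
      rw [← mul_pow]; ring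
    have h3 : (2 * Complex.I) ^ n ≠ 0 := pow_ne_zero _ (mul_ne_zero two_ne_zero hI)
    rw [h2]
    field_simp
  obtain ⟨hint, heq⟩ := PolydiscGreen.integrable_and_integral_prod_kernel_comp
    (fun j => PolydiscGreen.weaklySingular_cauchyKernel R (μ j - 1))
    (fun j => PolydiscGreen.weaklySingular_conjCauchyKernel R (ν j - 1)) hfc hz
    (G := fun j ζ => c j * PolydiscGreen.C3 R (z j) ζ (μ j) (ν j)) (fun j => by
      -- The kernel identity was proved off the circle `|ζ| = |z j|`, a null set.
      filter_upwards [ae_restrict_mem measurableSet_closedBall,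
        ae_restrict_of_ae (PolydiscGreen.ae_norm_ne ‖z j‖)] with ζ hζ hne
      have := PolydiscGreen.setIntegral_cauchyKernel_mul_conjCauchyKernel (μ j - 1) (ν j - 1)
        (PolydiscGreen.mem_polydisc.1 hz j) hζ (Ne.symm hne)
      rwa [Nat.sub_add_cancel (hμ j), Nat.sub_add_cancel (hν j)] at this)
  simp only [Finset.prod_mul_distrib, mul_assoc] at hint heq
  refine ⟨(integrable_const_mul_iff (isUnit_iff_ne_zero.2 hc0) _).1 hint, ?_⟩
  rw [integral_const_mul, hcC8, mul_assoc] at heq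
  rw [← heq, PolydiscGreen.greenOp, hGeq hz,
    PolydiscGreen.foldr_kernelOp_finRange
      (fun j => PolydiscGreen.weaklySingular_cauchyKernel R (μ j - 1)) (hF.continuousOn hα₀) hz]
  refine setIntegral_congr_fun (PolydiscGreen.isCompact_polydisc n R).measurableSet fun w hw => ?_
  rw [hFeq hw, PolydiscGreen.foldr_kernelOp_finRange
    (fun j => PolydiscGreen.weaklySingular_conjCauchyKernel R (ν j - 1)) hfc hw]
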